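/- Let $M$ be a smooth (finite-dimensional, boundaryless) manifold, $g$ a semi-Riemannian metric on $M$ (a smooth field of symmetric nondegenerate bilinear forms on the tangent spaces) and $\theta\in C^\infty(M)$. Let $\hat TM=TM\oplus\mathbb R$ be the graded tangent bundle, with sections $\hat X=X+h\xi$ ($X$ a vector field, $h$ a function, $\xi=(0,1)$ the odd generator). It is a Lie algebroid with anchor $\rho(X+h\xi)=X$ and bracket $$[X+h\xi,\,Y+k\xi]=[X,Y]+\bigl(X(k)-Y(h)\bigr)\xi .$$ Let $\hat g=(g,\theta)$ be the graded metric $\langle X+h\xi,\,Y+k\xi\rangle=g(X,Y)+hk\,e^{2\theta}$ on $\hat TM$. For a Lie algebroid $V$ (here $V=TM$ or $V=\hat TM$) with a semi-Riemannian metric $\langle\cdot,\cdot\rangle$, let sections act on functions through the anchor, and let $df(X)=X(f)$ (written $\hat d f$ on $\hat TM$). The Levi-Civita connection is given by the Koszul formula $$2\langle\nabla_XY,Z\rangle=X\langle Y,Z\rangle+Y\langle Z,X\rangle-Z\langle X,Y\rangle+\langle[X,Y],Z\rangle-\langle[Y,Z],X\rangle+\langle[Z,X],Y\rangle .$$ Put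 $R(X,Y)Z=\nabla_X\nabla_YZ-\nabla_Y\nabla_XZ-\nabla_{[X,Y]}Z$, $\mathrm{Ric}(X,Y)=\sum_i\varepsilon_i\langle R(X,E_i)E_i,Y\rangle$ for a local orthonormal frame $(E_i)$ of $V$ with $\varepsilon_i=\langle E_i,E_i\rangle=\pm1$, $\mathrm{Hes}(f)(X,Y)=X(Y(f))-(\nabla_XY)(f)$ and $\Delta f=\sum_i\varepsilon_i\,\mathrm{Hes}(f)(E_i,E_i)$. Write $\mathrm{Ric},\Delta$ for these objects on $(TM,g)$, and $\widehat{\mathrm{Ric}},\widehat{\mathrm{Hes}}$ for those on $(\hat TM,\hat g)$. **Theorem.** The pair $(g,\theta)$ satisfies $$\mathrm{Ric}=2\,d\theta\otimes d\theta\qquad\text{and}\qquad\Delta\theta=0\qquad\text{on }M$$ if and only if $\hat g$ satisfies $$\widehat{\mathrm{Ric}}=\hat d\theta\otimes\hat d\theta-\widehat{\mathrm{Hes}}(\theta)\qquad\text{on }\hat TM .$$ -/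

import Mathlib

open Bundle
open scoped Manifold ContDiff

noncomputable section

namespace GradedTangent

/-! ### Metric traces on a finite-dimensional vector space -/

/-- The trace `∑ᵢ T(eᵢ, eⁱ) = g^{ij} T(eᵢ, eⱼ)` of a 2-covariant tensor `T` with respect to a
nondegenerate bilinear form `B`; here `(eᵢ)` is a basis and `(eⁱ)` the `B`-dual basis,
`B(eⁱ, eⱼ) = δᵢⱼ`. For bilinear `T` this does not depend on the basis, and it is
`∑ᵢ ⟨Eᵢ, Eᵢ⟩ T(Eᵢ, Eᵢ)` for any `B`-orthonormal basis `(Eᵢ)`. -/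
def metricTrace {W : Type*} [AddCommGroup W] [Module ℝ W] [FiniteDimensional ℝ W]
    (B : LinearMap.BilinForm ℝ W) (hB : B.Nondegenerate) (T : W → W → ℝ) : ℝ :=
  ∑ i, T (Module.finBasis ℝ W i) (B.dualBasis hB (Module.finBasis ℝ W) i)

section General

variable {E : Type*} [NormedAddCommGroup E] [NormedSpace ℝ E]
  {H : Type*} [TopologicalSpace H] {I : ModelWithCorners ℝ E H}
  {M : Type*} [TopologicalSpace M] [ChartedSpace H M]
  {F : Type*} [NormedAddCommGroup F] [NormedSpace ℝ F]
  {V : M → Type*} [TopologicalSpace (TotalSpace F V)]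
  [∀ x, TopologicalSpace (V x)] [∀ x, AddCommGroup (V x)] [∀ x, Module ℝ (V x)]
  [FiberBundle F V] [VectorBundle ℝ F V]

variable (I F V) in
/-- A smooth semi-Riemannian metric on a vector bundle `V` over `M`: a smooth family of symmetric
nondegenerate bilinear forms on the fibres. -/
structure SemiRiemannianMetric where
  val (x : M) : V x →L[ℝ] V x →L[ℝ] ℝ
  symm (x : M) (v w : V x) : val x v w = val x w v
  nondegenerate (x : M) (v : V x) (hv : ∀ w, val x v w = 0) : v = 0
  smooth : ContMDiff I (I.prod 𝓘(ℝ, F →L[ℝ] F →L[ℝ] ℝ)) ∞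
    (fun x ↦ TotalSpace.mk' (F →L[ℝ] F →L[ℝ] ℝ) x (val x))

/-- The metric on the fibre at `x`, as an algebraic bilinear form. -/
def SemiRiemannianMetric.form (g : SemiRiemannianMetric I F V) (x : M) :
    LinearMap.BilinForm ℝ (V x) :=
  (g.val x).toLinearMap₁₂

theorem SemiRiemannianMetric.form_nondegenerate (g : SemiRiemannianMetric I F V) (x : M) :
    (g.form x).Nondegenerate := by
  refine ⟨fun v hv ↦ g.nondegenerate x v hv, fun v hv ↦ g.nondegenerate x v fun w ↦ ?_⟩
  rw [g.symm]
  exact hv w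

/-- The trace with respect to the metric `g` of a 2-covariant tensor on the fibre at `x`. -/
def SemiRiemannianMetric.trace [FiniteDimensional ℝ F] (g : SemiRiemannianMetric I F V) (x : M)
    (T : V x → V x → ℝ) : ℝ :=
  haveI : FiniteDimensional ℝ (V x) := VectorBundle.finiteDimensional ℝ F V x
  metricTrace (g.form x) (g.form_nondegenerate x) T

variable (I V) in
/-- The operations of a Lie algebroid `V → M`: the anchor `ρ : V → TM` and the bracket of
sections. The two Lie algebroids used below, `TM` and the graded tangent bundle, are
`tangentAlgebroid` and `gradedAlgebroid`. -/
structure AlgebroidOps where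
  anchor (x : M) : V x →L[ℝ] TangentSpace I x
  bracket : (Π x, V x) → (Π x, V x) → Π x, V x

namespace AlgebroidOps

variable (A : AlgebroidOps I V)

/-- The exterior derivative of a function `f`, the 1-form `v ↦ ρ(v)(f)` on `V`. -/
def d (f : M → ℝ) (x : M) (v : V x) : ℝ := mvfderiv I f x (A.anchor x v)

/-- The right hand side of the Koszul formula,
`X⟨Y,Z⟩ + Y⟨Z,X⟩ - Z⟨X,Y⟩ + ⟨[X,Y],Z⟩ - ⟨[Y,Z],X⟩ + ⟨[Z,X],Y⟩`,
where sections of `V` act on functions through the anchor. -/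
def koszul (g : SemiRiemannianMetric I F V) (X Y Z : Π x, V x) (x : M) : ℝ :=
  A.d (fun y ↦ g.val y (Y y) (Z y)) x (X x)
    + A.d (fun y ↦ g.val y (Z y) (X y)) x (Y x)
    - A.d (fun y ↦ g.val y (X y) (Y y)) x (Z x)
    + g.val x (A.bracket X Y x) (Z x)
    - g.val x (A.bracket Y Z x) (X x)
    + g.val x (A.bracket Z X x) (Y x)

open Classical in
/-- The Levi-Civita connection `∇_X Y` of the metric `g`: its value at `x` is the vector `v` of the
fibre at `x` determined by the Koszul formula, `2⟨v, Z⟩ = koszul X Y Z` at `x` for all sections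
`Z` that are smooth at `x`. It is unique since `g` is nondegenerate; the value is `0` where there
is no such `v` (which does not happen when `X` and `Y` are smooth at `x`). -/
def leviCivita (g : SemiRiemannianMetric I F V) (X Y : Π x, V x) (x : M) : V x :=
  if h : ∃ v : V x, ∀ Z : Π x, V x,
      ContMDiffAt I (I.prod 𝓘(ℝ, F)) ∞ (fun y ↦ TotalSpace.mk' F y (Z y)) x →
        2 * g.val x v (Z x) = A.koszul g X Y Z x
  then h.choose else 0

/-- The curvature `R(X,Y)Z = ∇_X ∇_Y Z - ∇_Y ∇_X Z - ∇_{[X,Y]} Z`. -/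
def curvature (g : SemiRiemannianMetric I F V) (X Y Z : Π x, V x) (x : M) : V x :=
  A.leviCivita g X (A.leviCivita g Y Z) x - A.leviCivita g Y (A.leviCivita g X Z) x
    - A.leviCivita g (A.bracket X Y) Z x

/-- The curvature tensor `R(u,v)w` on the fibre at `x`, computed with sections that are smooth near
`x` and take the values `u`, `v`, `w` at `x`. -/
def curvatureTensor (g : SemiRiemannianMetric I F V) (x : M) (u v w : V x) : V x :=
  A.curvature g (FiberBundle.extend F u) (FiberBundle.extend F v) (FiberBundle.extend F w) x

/-- The Ricci tensor `Ric(u,v) = ∑ᵢ ⟨Eᵢ,Eᵢ⟩ ⟨R(u,Eᵢ)Eᵢ, v⟩`, the metric trace of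
`(w,z) ↦ ⟨R(u,w)z, v⟩`. -/
def ricci [FiniteDimensional ℝ F] (g : SemiRiemannianMetric I F V) (x : M) (u v : V x) : ℝ :=
  g.trace x fun w z ↦ g.val x (A.curvatureTensor g x u w z) v

/-- The covariant derivative of a 1-form, `(∇_X α)(Y) = X(α(Y)) - α(∇_X Y)`. -/
def covDerivForm (g : SemiRiemannianMetric I F V) (X : Π x, V x) (α : Π x, V x → ℝ)
    (Y : Π x, V x) (x : M) : ℝ :=
  A.d (fun y ↦ α y (Y y)) x (X x) - α x (A.leviCivita g X Y x)

/-- The Hessian tensor `Hes(f)(u,v) = (∇_u df)(v)` on the fibre at `x`. -/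
def hessian (g : SemiRiemannianMetric I F V) (f : M → ℝ) (x : M) (u v : V x) : ℝ :=
  A.covDerivForm g (FiberBundle.extend F u) (A.d f) (FiberBundle.extend F v) x

/-- The Laplacian `Δf = tr Hes(f)`. -/
def laplacian [FiniteDimensional ℝ F] (g : SemiRiemannianMetric I F V) (f : M → ℝ) (x : M) : ℝ :=
  g.trace x (A.hessian g f x)

end AlgebroidOps

end General

section Concrete

variable {E : Type*} [NormedAddCommGroup E] [NormedSpace ℝ E]
  {H : Type*} [TopologicalSpace H] (I : ModelWithCorners ℝ E H)
  (M : Type*) [TopologicalSpace M] [ChartedSpace H M]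

/-- The tangent bundle as a Lie algebroid: the anchor is the identity, the bracket is the Lie
bracket of vector fields. -/
def tangentAlgebroid : AlgebroidOps I (fun x : M ↦ TangentSpace I x) where
  anchor x := ContinuousLinearMap.id ℝ (TangentSpace I x)
  bracket X Y := VectorField.mlieBracket I X Y

/-- The graded tangent bundle `T̂M = TM ⊕ ℝ`. The pair `(v, a)` in the fibre at `x` stands for
`v + a ξ`; the first component is the even part, the second one the odd part. -/
abbrev GradedTangentSpace : M → Type _ :=
  (fun x : M ↦ TangentSpace I x) ×ᵇ (Bundle.Trivial M ℝ)

/-- The graded tangent bundle as a Lie algebroid: `ρ(X + hξ) = X` and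
`[X + hξ, Y + kξ] = [X,Y] + (X(k) - Y(h)) ξ`. This is the bracket of graded derivations of the
algebra of functions `a + bτ`, on which `X` acts as `a + bτ ↦ X(a) + X(b)τ` and `hξ` as
`a + bτ ↦ hb`. -/
def gradedAlgebroid : AlgebroidOps I (GradedTangentSpace I M) where
  anchor x := ContinuousLinearMap.fst ℝ (TangentSpace I x) ℝ
  bracket X Y := fun x ↦
    (VectorField.mlieBracket I (fun y ↦ (X y).1) (fun y ↦ (Y y).1) x,
      mvfderiv I (fun y ↦ ((Y y).2 : ℝ)) x (X x).1 - mvfderiv I (fun y ↦ ((X y).2 : ℝ)) x (Y x).1)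

variable {I M}

/-- The bilinear form `⟨u + aξ, v + bξ⟩ = g(u,v) + a b e^{2θ}` on a fibre of `T̂M`. -/
def gradedForm [IsManifold I ∞ M] (g : SemiRiemannianMetric I E (fun x : M ↦ TangentSpace I x))
    (θ : M → ℝ) (x : M) :
    GradedTangentSpace I M x →L[ℝ] GradedTangentSpace I M x →L[ℝ] ℝ :=
  (ContinuousLinearMap.precomp ℝ (ContinuousLinearMap.fst ℝ (TangentSpace I x) ℝ)).comp
      ((g.val x).comp (ContinuousLinearMap.fst ℝ (TangentSpace I x) ℝ))
    + Real.exp (2 * θ x) • (ContinuousLinearMap.snd ℝ (TangentSpace I x) ℝ).smulRight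
        (ContinuousLinearMap.snd ℝ (TangentSpace I x) ℝ)

theorem gradedForm_apply [IsManifold I ∞ M]
    (g : SemiRiemannianMetric I E (fun x : M ↦ TangentSpace I x))
    (θ : M → ℝ) (x : M) (u v : GradedTangentSpace I M x) :
    gradedForm g θ x u v = g.val x u.1 v.1 + Real.exp (2 * θ x) * ((u.2 : ℝ) * (v.2 : ℝ)) := rfl

/-- The graded metric `ĝ = (g, θ)` on `T̂M`. -/
def gradedMetric [IsManifold I ∞ M]
    (g : SemiRiemannianMetric I E (fun x : M ↦ TangentSpace I x))
    (θ : M → ℝ) (hθ : ContMDiff I 𝓘(ℝ) ∞ θ) :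
    SemiRiemannianMetric I (E × ℝ) (GradedTangentSpace I M) where
  val := gradedForm g θ
  symm x v w := by
    rw [gradedForm_apply, gradedForm_apply, g.symm, mul_comm (v.2 : ℝ)]
  nondegenerate x v hv := by
    refine Prod.ext (g.nondegenerate x _ fun w ↦ ?_) ?_
    · simpa [gradedForm_apply] using hv (w, (0 : ℝ))
    · simpa [gradedForm_apply] using hv ((0 : TangentSpace I x), (1 : ℝ))
  smooth := by
    intro x₀
    have hg := ((contMDiffAt_hom_bundle _).1 (g.smooth x₀)).2
    refine (contMDiffAt_hom_bundle _).2 ⟨contMDiffAt_id, ?_⟩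
    have hexp : ContMDiffAt I 𝓘(ℝ) ∞ (fun x ↦ Real.exp (2 * θ x)) x₀ :=
      (Real.contDiff_exp.contMDiff.comp (contMDiff_const.mul hθ)) x₀
    have h1 := (contMDiffAt_const
      (c := ContinuousLinearMap.precomp ℝ (ContinuousLinearMap.fst ℝ E ℝ))).clm_comp
        (hg.clm_comp (contMDiffAt_const (c := ContinuousLinearMap.fst ℝ E ℝ)))
    have h2 := hexp.smul (contMDiffAt_const (I := I) (I' := 𝓘(ℝ, E × ℝ →L[ℝ] E × ℝ →L[ℝ] ℝ))
      (c := (ContinuousLinearMap.snd ℝ E ℝ).smulRight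
        (ContinuousLinearMap.snd ℝ E ℝ)))
    refine (h1.add h2).congr_of_eventuallyEq ?_
    have hb := (trivializationAt E (fun x : M ↦ TangentSpace I x) x₀).open_baseSet.mem_nhds
      (FiberBundle.mem_baseSet_trivializationAt E (fun x : M ↦ TangentSpace I x) x₀)
    filter_upwards [hb] with x hx
    have hx' : x ∈ (trivializationAt (E × ℝ) (GradedTangentSpace I M) x₀).baseSet :=
      ⟨hx, Set.mem_univ _⟩
    have hs (v : E × ℝ) : (trivializationAt (E × ℝ) (GradedTangentSpace I M) x₀).symm x v =
        ((trivializationAt E (fun x : M ↦ TangentSpace I x) x₀).symm x v.1, v.2) := by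
      have h := (trivializationAt (E × ℝ) (GradedTangentSpace I M) x₀).symm_apply_apply_mk hx'
        ((trivializationAt E (fun x : M ↦ TangentSpace I x) x₀).symm x v.1, v.2)
      refine Eq.trans (congrArg _ ?_) h
      refine Prod.ext ?_ rfl
      exact congrArg Prod.snd ((trivializationAt E (fun x : M ↦ TangentSpace I x) x₀).apply_mk_symm
        hx v.1).symm
    refine ContinuousLinearMap.ext fun v ↦ ContinuousLinearMap.ext fun w ↦ ?_
    refine (inCoordinates_apply_eq₂ (F₁ := E × ℝ) (F₂ := E × ℝ) (F₃ := ℝ)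
      (E₁ := GradedTangentSpace I M) (E₂ := GradedTangentSpace I M) (E₃ := Bundle.Trivial M ℝ)
      (x₀ := x₀) (x := x) (ϕ := gradedForm g θ x) (v := v) (w := w)
      hx' hx' (Set.mem_univ _)).trans ?_
    have e3 := inCoordinates_apply_eq₂ (F₁ := E) (F₂ := E) (F₃ := ℝ)
      (E₁ := fun x : M ↦ TangentSpace I x) (E₂ := fun x : M ↦ TangentSpace I x)
      (E₃ := Bundle.Trivial M ℝ) (x₀ := x₀) (x := x) (ϕ := g.val x) (v := v.1) (w := w.1)
      hx hx (Set.mem_univ _)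
    simp only [Bundle.Trivial.fiberBundle_trivializationAt',
      Bundle.Trivial.linearMapAt_trivialization, LinearMap.id_apply] at e3 ⊢
    rw [hs, hs, gradedForm_apply]
    exact congrArg (· + Real.exp (2 * θ x) * (v.2 * w.2)) e3.symm

end Concrete

end GradedTangent

end

/-!
The graded metric is formally the warped product metric `g + e^{2θ} ξ* ⊗ ξ*` on `M × ℝ`, restricted
to objects that do not depend on the second coordinate, and its curvature is computed as for a
warped product with warping function `e^θ`.

The Koszul formula determines the Levi-Civita connection (`leviCivita_eq`), and it gives
`∇̂_{X + hξ} (Y + kξ) = ∇_X Y - h k e^{2θ} grad θ + (X(k) + k X(θ) + h Y(θ)) ξ`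
(`leviCivita_graded`). Differentiating once more, the curvature of `ĝ` is that of `g` plus terms
in the single endomorphism `K v = ∇_v grad θ + dθ(v) grad θ`, which is metrically equivalent to
`Hes(θ) + dθ ⊗ dθ` (`curvature_graded`, `metric_warpEndo`).

A metric trace is the trace of the metrically equivalent endomorphism (`metricTrace_eq_trace`). For
the Ricci tensor of `ĝ` this endomorphism acts on `T_xM × ℝ`, and its two diagonal blocks yield
(`ricci_graded`)
`Riĉ(u + aξ, v + sξ) = Ric(u,v) - Hes(θ)(u,v) - dθ(u) dθ(v) - a s e^{2θ} (Δθ + |dθ|²)`.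
The same connection formula gives (`hessian_graded`)
`Heŝ(θ)(u + aξ, v + sξ) = Hes(θ)(u,v) + a s e^{2θ} |dθ|²`.
Hence the graded equation reads
`Ric(u,v) - a s e^{2θ} Δθ = 2 dθ(u) dθ(v)` for all `u`, `v`, `a`, `s`,
and since `e^{2θ}` does not vanish, it splits into the two equations on `M`.

Apart from this computation, what has to be supplied is the Levi-Civita connection of a
semi-Riemannian metric itself: its existence (`tensorialAt_koszul`), its smoothness
(`contMDiffAt_nabla`, by `contMDiffAt_of_metric_apply`) and its linearity. Sections extending given
vectors are linear in them, and have constant odd part, only near the base point, so the identities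
are stated for sections that agree near a point.
-/

noncomputable section

namespace GradedTangent

open Filter Topology

/-! ### Smooth sections, metrics and Lie brackets -/

section Bundles

variable {E : Type*} [NormedAddCommGroup E] [NormedSpace ℝ E]
  {H : Type*} [TopologicalSpace H] {I : ModelWithCorners ℝ E H}
  {M : Type*} [TopologicalSpace M] [ChartedSpace H M]
  {F : Type*} [NormedAddCommGroup F] [NormedSpace ℝ F]
  {V : M → Type*} [TopologicalSpace (TotalSpace F V)]
  [∀ x, TopologicalSpace (V x)] [FiberBundle F V]

theorem mdiffAt_section {x : M} {X : Π x, V x} (hX : CMDiffAt ∞ (T% X) x) :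
    MDiffAt (T% X) x :=
  hX.mdifferentiableAt (by simp)

variable [∀ x, AddCommGroup (V x)] [∀ x, Module ℝ (V x)] [VectorBundle ℝ F V]

theorem extend_eq_symmL {x : M} {v : V x} {y : M} (hy : y ∈ (trivializationAt F V x).baseSet) :
    FiberBundle.extend F v y = (trivializationAt F V x).symmL ℝ y
      ((trivializationAt F V x).continuousLinearMapAt ℝ x v) := by
  have hx := FiberBundle.mem_baseSet_trivializationAt F V x
  simp [FiberBundle.extend, Trivialization.coe_linearMapAt_of_mem _ hx, hy]

/-- `FiberBundle.extend` is given by a linear map over the base set of the trivialization, and by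
junk values outside of it. -/
theorem eventually_extend_add {x : M} (v w : V x) :
    ∀ᶠ y in 𝓝 x, FiberBundle.extend F (v + w) y =
      FiberBundle.extend F v y + FiberBundle.extend F w y := by
  have hx := FiberBundle.mem_baseSet_trivializationAt F V x
  filter_upwards [(trivializationAt F V x).open_baseSet.mem_nhds hx] with y hy
  simp only [extend_eq_symmL hy, map_add]

theorem eventually_extend_smul {x : M} (c : ℝ) (v : V x) :
    ∀ᶠ y in 𝓝 x, FiberBundle.extend F (c • v) y = c • FiberBundle.extend F v y := by
  have hx := FiberBundle.mem_baseSet_trivializationAt F V x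
  filter_upwards [(trivializationAt F V x).open_baseSet.mem_nhds hx] with y hy
  simp only [extend_eq_symmL hy, map_smul]

theorem contMDiffAt_metric_apply (g : SemiRiemannianMetric I F V) {x : M} {X Y : Π x, V x}
    (hX : CMDiffAt ∞ (T% X) x) (hY : CMDiffAt ∞ (T% Y) x) :
    CMDiffAt ∞ (fun y ↦ g.val y (X y) (Y y)) x := by
  have : ContMDiffAt I (I.prod 𝓘(ℝ)) ∞
      (fun m ↦ TotalSpace.mk' ℝ (E := Bundle.Trivial M ℝ) m (g.val m (X m) (Y m))) x :=
    ContMDiffAt.clm_bundle_apply₂ (F₁ := F) (F₂ := F) (g.smooth x) hX hY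
  simp only [contMDiffAt_totalSpace] at this
  exact this.2

theorem mdifferentiableAt_metric_apply (g : SemiRiemannianMetric I F V) {x : M} {X Y : Π x, V x}
    (hX : MDiffAt (T% X) x) (hY : MDiffAt (T% Y) x) :
    MDiffAt (fun y ↦ g.val y (X y) (Y y)) x := by
  have hg : MDiffAt (fun x ↦ TotalSpace.mk' (F →L[ℝ] F →L[ℝ] ℝ)
      (E := fun x ↦ V x →L[ℝ] V x →L[ℝ] ℝ) x (g.val x)) x :=
    (g.smooth x).mdifferentiableAt (by simp)
  have : MDifferentiableAt I (I.prod 𝓘(ℝ))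
      (fun m ↦ TotalSpace.mk' ℝ (E := Bundle.Trivial M ℝ) m (g.val m (X m) (Y m))) x :=
    MDifferentiableAt.clm_bundle_apply₂ (F₁ := F) (F₂ := F) hg hX hY
  simp only [mdifferentiableAt_totalSpace] at this
  exact this.2

theorem eventually_mdifferentiableAt_section [IsManifold I 1 M] [ContMDiffVectorBundle 1 F V I]
    {x : M} {X : Π x, V x} (hX : CMDiffAt ∞ (T% X) x) : ∀ᶠ y in 𝓝 x, MDiffAt (T% X) y := by
  have := ((contMDiffAt_iff_contMDiffAt_nhds (n := 1) (by simp)).1 (hX.of_le (by simp)))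
  filter_upwards [this] with y hy using hy.mdifferentiableAt one_ne_zero

theorem eventually_mdifferentiableAt [IsManifold I 1 M] {x : M} {f : M → ℝ}
    (hX : CMDiffAt ∞ f x) : ∀ᶠ y in 𝓝 x, MDiffAt f y := by
  have := ((contMDiffAt_iff_contMDiffAt_nhds (n := 1) (by simp)).1 (hX.of_le (by simp)))
  filter_upwards [this] with y hy using hy.mdifferentiableAt one_ne_zero

theorem mvfderiv_congr {x : M} {f f' : M → ℝ} (h : ∀ᶠ y in 𝓝 x, f y = f' y) :
    mvfderiv I f x = mvfderiv I f' x := by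
  simp only [mvfderiv, Filter.EventuallyEq.mfderiv_eq h]
  rfl

theorem contMDiffAt_mvfderiv_apply [IsManifold I 1 M] {x : M} {f : M → ℝ}
    {X : Π x, TangentSpace I x} (hf : CMDiffAt ∞ f x) (hX : CMDiffAt ∞ (T% X) x) :
    CMDiffAt ∞ (fun y ↦ mvfderiv I f y (X y)) x := by
  have h1 := hf.mfderiv_const (m := ∞) (by simp)
  have h2 := ContMDiffAt.clm_apply_of_inCoordinates (b₁ := id) h1 hX hf
  simp only [contMDiffAt_totalSpace] at h2
  have h3 := h2.2
  simp at h3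
  exact h3

theorem contMDiffAt_extend_tangent [IsManifold I ∞ M] {x : M} (v : TangentSpace I x) :
    CMDiffAt ∞ (T% (FiberBundle.extend E v)) x := FiberBundle.contMDiffAt_extend I E v

theorem contMDiffAt_clm_of_apply [FiniteDimensional ℝ F] {n : ℕ∞ω} {x : M} {φ : M → F →L[ℝ] ℝ}
    (h : ∀ v, CMDiffAt n (fun y ↦ φ y v) x) : CMDiffAt n φ x := by
  let b := Module.finBasis ℝ F
  have hφ : φ = fun y ↦ ∑ i, φ y (b i) • LinearMap.toContinuousLinearMap (b.coord i) := by
    funext y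
    ext v
    have hv := congrArg (φ y) (b.sum_repr v)
    rw [← hv, map_sum]
    simp [mul_comm]
  rw [hφ]
  refine contMDiffAt_finsetSum fun i _ ↦ ?_
  exact (h (b i)).smul contMDiffAt_const

/-- A section is smooth as soon as all its metric products with smooth sections are. In a
trivialization the metric is a smooth family `G` of isomorphisms `F → F*`; testing against sections
with constant coordinates shows that `G X` is smooth, and `X` is recovered by inverting `G`. -/
theorem contMDiffAt_of_metric_apply [FiniteDimensional ℝ F] [ContMDiffVectorBundle ∞ F V I]
    (g : SemiRiemannianMetric I F V) {x : M} {X : Π x, V x}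
    (h : ∀ Y : Π x, V x, CMDiffAt ∞ (T% Y) x → CMDiffAt ∞ (fun y ↦ g.val y (X y) (Y y)) x) :
    CMDiffAt ∞ (T% X) x := by
  set t := trivializationAt F V x with ht
  have hx : x ∈ t.baseSet := FiberBundle.mem_baseSet_trivializationAt F V x
  have hg := ((contMDiffAt_hom_bundle _).1 (g.smooth x)).2
  set G : M → F →L[ℝ] F →L[ℝ] ℝ := fun y ↦ ContinuousLinearMap.inCoordinates F V (F →L[ℝ] ℝ)
    (fun y ↦ V y →L[ℝ] ℝ) x y x y (g.val y) with hG
  have hGa : ∀ y ∈ t.baseSet, ∀ a b : F, G y a b = g.val y (t.symm y a) (t.symm y b) := by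
    intro y hy a b
    refine (inCoordinates_apply_eq₂ (F₁ := F) (F₂ := F) (F₃ := ℝ)
      (E₁ := V) (E₂ := V) (E₃ := Bundle.Trivial M ℝ)
      (x₀ := x) (x := y) (ϕ := g.val y) (v := a) (w := b)
      hy hy (Set.mem_univ _)).trans ?_
    simp
    rfl
  rw [contMDiffAt_section]
  have hGX : CMDiffAt ∞ (fun y ↦ G y (t ⟨y, X y⟩).2) x := by
    refine contMDiffAt_clm_of_apply fun v ↦ ?_
    have h1 := h (FiberBundle.extend F (t.symm x v))
      (FiberBundle.contMDiffAt_extend I F _)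
    refine h1.congr_of_eventuallyEq ?_
    filter_upwards [t.open_baseSet.mem_nhds hx] with y hy
    rw [hGa y hy]
    simp [FiberBundle.extend, ← ht, hx, hy]
  have hinj : Function.Injective (G x) := by
    rw [injective_iff_map_eq_zero]
    intro a ha
    have h0 : t.symm x a = 0 := by
      refine g.nondegenerate x _ fun w ↦ ?_
      have := hGa x hx a (t ⟨x, w⟩).2
      rw [ha] at this
      simpa [hx] using this.symm
    have := t.apply_mk_symm hx a
    rw [h0] at this
    have h1 : t ⟨x, 0⟩ = (x, 0) := t.zeroSection ℝ hx
    rw [h1] at this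
    exact (congrArg Prod.snd this).symm
  have hfin : Module.finrank ℝ F = Module.finrank ℝ (F →L[ℝ] ℝ) := by
    rw [← (LinearMap.toContinuousLinearMap (𝕜 := ℝ) (E := F) (F' := ℝ)).finrank_eq]
    exact Subspace.dual_finrank_eq.symm
  let e : F ≃L[ℝ] (F →L[ℝ] ℝ) :=
    (LinearEquiv.ofInjectiveOfFinrankEq (G x).toLinearMap hinj hfin).toContinuousLinearEquiv
  have he : (e : F →L[ℝ] (F →L[ℝ] ℝ)) = G x := by
    ext; rfl
  have : CompleteSpace F := FiniteDimensional.complete ℝ F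
  have hinv : CMDiffAt ∞ (fun y ↦ ContinuousLinearMap.inverse (G y)) x := by
    have := (contDiffAt_map_inverse (n := ∞) e)
    rw [he] at this
    exact this.contMDiffAt.comp x hg
  refine (hinv.clm_apply hGX).congr_of_eventuallyEq ?_
  have hev : ∀ᶠ y in 𝓝 x, (G y).IsInvertible := by
    have := e.nhds
    rw [he] at this
    filter_upwards [hg.continuousAt.preimage_mem_nhds this] with y hy
    obtain ⟨e', he'⟩ := hy
    exact ⟨e', he'⟩
  filter_upwards [hev] with y hy
  exact (hy.inverse_apply_self _).symm

/-- The chain rule for a function read in a chart. -/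
theorem fderivWithin_comp_extChartAt_symm [IsManifold I 1 M] {x : M} {f : M → ℝ} {z : E}
    (hz : z ∈ (extChartAt I x).target) (hf : MDiffAt f ((extChartAt I x).symm z)) (u : E) :
    fderivWithin ℝ (f ∘ (extChartAt I x).symm) (Set.range I) z u =
    mvfderiv I f ((extChartAt I x).symm z)
      (mfderivWithin 𝓘(ℝ, E) I (extChartAt I x).symm (Set.range I) z u) := by
  have h1 := mfderiv_comp_mfderivWithin (I := 𝓘(ℝ, E)) (I' := I) (I'' := 𝓘(ℝ)) z hf
    (mdifferentiableWithinAt_extChartAt_symm hz)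
    (I.uniqueMDiffOn _ (extChartAt_target_subset_range x hz))
  rw [mfderivWithin_eq_fderivWithin] at h1
  exact congrArg (fun L : E →L[ℝ] ℝ ↦ L u) h1

theorem fderivWithin_comp_extChartAt_symm_mpullback [IsManifold I 1 M] {x : M} {f : M → ℝ} {z : E}
    (hz : z ∈ (extChartAt I x).target) (hf : MDiffAt f ((extChartAt I x).symm z))
    (X : Π x, TangentSpace I x) :
    fderivWithin ℝ (f ∘ (extChartAt I x).symm) (Set.range I) z
      (VectorField.mpullbackWithin 𝓘(ℝ, E) I (extChartAt I x).symm X (Set.range I) z) =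
    mvfderiv I f ((extChartAt I x).symm z) (X ((extChartAt I x).symm z)) := by
  refine (fderivWithin_comp_extChartAt_symm hz hf _).trans (congrArg _ ?_)
  rw [VectorField.mpullbackWithin_apply]
  exact (isInvertible_mfderivWithin_extChartAt_symm hz).self_apply_inverse _

/-- `[X, Y](f) = X(Y(f)) - Y(X(f))`: the Lie bracket of the manifold is defined by pulling back to
the model space, so the identity is transported from the corresponding one there. -/
theorem mvfderiv_mlieBracket [IsManifold I ∞ M] [CompleteSpace E] {x : M} {f : M → ℝ}
    {X Y : Π x, TangentSpace I x} (hf : CMDiffAt ∞ f x) (hX : CMDiffAt ∞ (T% X) x)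
    (hY : CMDiffAt ∞ (T% Y) x) :
    mvfderiv I f x (VectorField.mlieBracket I X Y x) =
      mvfderiv I (fun y ↦ mvfderiv I f y (Y y)) x (X x)
        - mvfderiv I (fun y ↦ mvfderiv I f y (X y)) x (Y x) := by
  set φ := extChartAt I x with hφ
  set X' := VectorField.mpullbackWithin 𝓘(ℝ, E) I φ.symm X (Set.range I) with hX'
  set Y' := VectorField.mpullbackWithin 𝓘(ℝ, E) I φ.symm Y (Set.range I) with hY'
  have hxt : φ x ∈ φ.target := mem_extChartAt_target x
  have hxx : φ.symm (φ x) = x := extChartAt_to_inv x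
  have hfd : MDiffAt f x := hf.mdifferentiableAt (by simp)
  have hev : ∀ᶠ z in 𝓝[Set.range I] (φ x), z ∈ φ.target ∧ MDiffAt f (φ.symm z) := by
    have h1 := (continuousAt_extChartAt_symm (I := I) x).preimage_mem_nhds
      (by rw [hxx]; exact eventually_mdifferentiableAt hf)
    filter_upwards [extChartAt_target_mem_nhdsWithin x, mem_nhdsWithin_of_mem_nhds h1]
      with z hz hz' using ⟨hz, hz'⟩
  have key (Z : Π x, TangentSpace I x) (hZ : CMDiffAt ∞ (T% Z) x) (W : Π x, TangentSpace I x) :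
      fderivWithin ℝ (fun z ↦ fderivWithin ℝ (f ∘ φ.symm) (Set.range I) z
          (VectorField.mpullbackWithin 𝓘(ℝ, E) I φ.symm Z (Set.range I) z)) (Set.range I) (φ x)
          (VectorField.mpullbackWithin 𝓘(ℝ, E) I φ.symm W (Set.range I) (φ x)) =
        mvfderiv I (fun y ↦ mvfderiv I f y (Z y)) x (W x) := by
    have hd : MDiffAt (fun y ↦ mvfderiv I f y (Z y)) (φ.symm (φ x)) := by
      rw [hxx]
      exact (contMDiffAt_mvfderiv_apply hf hZ).mdifferentiableAt (by simp)
    have h2 := fderivWithin_comp_extChartAt_symm_mpullback hxt hd W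
    rw [← hφ, hxx] at h2
    rw [← h2]
    congr 1
    refine Filter.EventuallyEq.fderivWithin_eq_of_mem ?_ (Set.mem_range_self _)
    filter_upwards [hev] with z hz
    exact fderivWithin_comp_extChartAt_symm_mpullback hz.1 hz.2 Z
  have hd (Z : Π x, TangentSpace I x) (hZ : CMDiffAt ∞ (T% Z) x) : DifferentiableWithinAt ℝ
      (VectorField.mpullbackWithin 𝓘(ℝ, E) I φ.symm Z (Set.range I)) (Set.range I) (φ x) := by
    have hZ' : MDiffAt[Set.univ] (T% Z) x :=
      (hZ.mdifferentiableAt (by simp)).mdifferentiableWithinAt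
    have := hZ'.differentiableWithinAt_mpullbackWithin_vectorField
    rwa [Set.preimage_univ, Set.univ_inter] at this
  have hfc : ContDiffWithinAt ℝ 2 (f ∘ φ.symm) (Set.range I) (φ x) := by
    have := (contMDiffAt_iff.1 hf).2
    exact this.of_le ENat.LEInfty.out
  have hlie := VectorField.fderivWithin_apply_lieBracket hfc (by simp) I.uniqueDiffOn
    (I.range_subset_closure_interior (Set.mem_range_self _)) (Set.mem_range_self _)
    (hd Y hY) (hd X hX)
  rw [key Y hY X, key X hX Y] at hlie
  rw [← hlie, ← VectorField.mlieBracketWithin_univ, VectorField.mlieBracketWithin_apply]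
  have hfd' : MDiffAt f (φ.symm (φ x)) := by rwa [hxx]
  rw [fderivWithin_comp_extChartAt_symm hxt hfd']
  simp only [Set.preimage_univ, Set.univ_inter]
  have e1 : (mfderiv I 𝓘(ℝ, E) φ x).inverse =
      mfderivWithin 𝓘(ℝ, E) I φ.symm (Set.range I) (φ x) := by
    apply ContinuousLinearMap.inverse_eq
    · have := mfderiv_extChartAt_comp_mfderivWithin_extChartAt_symm hxt
      rw [← hφ, hxx] at this
      exact this
    · have := mfderivWithin_extChartAt_symm_comp_mfderiv_extChartAt hxt
      rw [← hφ, hxx] at this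
      exact this
  rw [e1, hxx]

theorem contMDiffAt_mlieBracket [IsManifold I ∞ M] [CompleteSpace E] {x : M}
    {X Y : Π x : M, TangentSpace I x} (hX : CMDiffAt ∞ (T% X) x) (hY : CMDiffAt ∞ (T% Y) x) :
    CMDiffAt ∞ (T% (VectorField.mlieBracket I X Y)) x :=
  have : IsManifold I (minSmoothness ℝ 2) M := by simp; infer_instance
  have : IsManifold I (((⊤ : ℕ∞) : ℕ∞ω) + 1) M := by simpa
  ContMDiffAt.mlieBracket_vectorField (m := ⊤) (n := ⊤) hX hY (by simp)

end Bundles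

/-! ### The Levi-Civita connection -/

section Metric

variable {E : Type*} [NormedAddCommGroup E] [NormedSpace ℝ E]
  {H : Type*} [TopologicalSpace H] {I : ModelWithCorners ℝ E H}
  {M : Type*} [TopologicalSpace M] [ChartedSpace H M]
  {F : Type*} [NormedAddCommGroup F] [NormedSpace ℝ F]
  {V : M → Type*} [TopologicalSpace (TotalSpace F V)]
  [∀ x, TopologicalSpace (V x)] [∀ x, AddCommGroup (V x)] [∀ x, Module ℝ (V x)]
  [FiberBundle F V] [VectorBundle ℝ F V]

theorem eq_of_metric_eq (g : SemiRiemannianMetric I F V) {x : M} {v w : V x}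
    (h : ∀ z, g.val x v z = g.val x w z) : v = w := by
  refine sub_eq_zero.1 (g.nondegenerate x _ fun z ↦ ?_)
  rw [map_sub, sub_apply, h, sub_self]

/-- The musical isomorphism: every linear form on a fibre is represented by a vector. -/
theorem exists_metric_eq [FiniteDimensional ℝ F] (g : SemiRiemannianMetric I F V) (x : M)
    (φ : V x →ₗ[ℝ] ℝ) : ∃ v, ∀ w, g.val x v w = φ w := by
  have : FiniteDimensional ℝ (V x) := VectorBundle.finiteDimensional ℝ F V x
  exact ⟨((g.form x).toDual (g.form_nondegenerate x)).symm φ, fun w ↦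
    LinearMap.BilinForm.apply_toDual_symm_apply (B := g.form x) φ w⟩

/-- The Koszul formula characterizes the Levi-Civita connection: its value at `x` is any vector
that satisfies the formula against all sections smooth at `x`. -/
theorem leviCivita_eq [ContMDiffVectorBundle ∞ F V I] (A : AlgebroidOps I V)
    (g : SemiRiemannianMetric I F V) {X Y : Π x, V x} {x : M} {v : V x}
    (h : ∀ Z : Π x, V x, CMDiffAt ∞ (T% Z) x → 2 * g.val x v (Z x) = A.koszul g X Y Z x) :
    A.leviCivita g X Y x = v := by
  have hex : ∃ v : V x, ∀ Z : Π x, V x,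
      ContMDiffAt I (I.prod 𝓘(ℝ, F)) ∞ (fun y ↦ TotalSpace.mk' F y (Z y)) x →
        2 * g.val x v (Z x) = A.koszul g X Y Z x := ⟨v, h⟩
  rw [AlgebroidOps.leviCivita, dif_pos hex]
  refine eq_of_metric_eq g fun z ↦ ?_
  have hz := FiberBundle.contMDiffAt_extend (k := ∞) I F z
  have h1 := hex.choose_spec _ hz
  have h2 := h _ hz
  rw [FiberBundle.extend_apply_self] at h1 h2
  linarith

theorem leviCivita_congr_of_koszul (A : AlgebroidOps I V) (g : SemiRiemannianMetric I F V)
    {X Y X' Y' : Π x, V x} {x : M} (h : ∀ Z, A.koszul g X Y Z x = A.koszul g X' Y' Z x) :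
    A.leviCivita g X Y x = A.leviCivita g X' Y' x := by
  have hP : (fun v : V x ↦ ∀ Z : Π x, V x,
      ContMDiffAt I (I.prod 𝓘(ℝ, F)) ∞ (fun y ↦ TotalSpace.mk' F y (Z y)) x →
        2 * g.val x v (Z x) = A.koszul g X Y Z x) = fun v ↦ ∀ Z : Π x, V x,
      ContMDiffAt I (I.prod 𝓘(ℝ, F)) ∞ (fun y ↦ TotalSpace.mk' F y (Z y)) x →
        2 * g.val x v (Z x) = A.koszul g X' Y' Z x := by simp only [h]
  exact congrArg (fun P : V x → Prop ↦ open Classical in if h : ∃ v, P v then h.choose else 0) hP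

theorem mvfderiv_metric_add_left (g : SemiRiemannianMetric I F V) {x : M} {X X' Y : Π x, V x}
    (hX : MDiffAt (T% X) x) (hX' : MDiffAt (T% X') x) (hY : MDiffAt (T% Y) x) :
    mvfderiv I (fun y ↦ g.val y ((X + X') y) (Y y)) x =
      mvfderiv I (fun y ↦ g.val y (X y) (Y y)) x + mvfderiv I (fun y ↦ g.val y (X' y) (Y y)) x := by
  rw [← mvfderiv_fun_add (mdifferentiableAt_metric_apply g hX hY)
    (mdifferentiableAt_metric_apply g hX' hY)]
  congr 1
  funext y
  simp

theorem mvfderiv_metric_smul_left (g : SemiRiemannianMetric I F V) {x : M} {f : M → ℝ}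
    {X Y : Π x, V x} (hf : MDiffAt f x) (hX : MDiffAt (T% X) x) (hY : MDiffAt (T% Y) x) :
    mvfderiv I (fun y ↦ g.val y ((f • X) y) (Y y)) x =
      f x • mvfderiv I (fun y ↦ g.val y (X y) (Y y)) x + g.val x (X x) (Y x) • mvfderiv I f x := by
  rw [← mvfderiv_fun_mul hf (mdifferentiableAt_metric_apply g hX hY)]
  congr 1
  funext y
  simp

theorem metric_symm_fun (g : SemiRiemannianMetric I F V) (X Y : Π x, V x) :
    (fun y ↦ g.val y (X y) (Y y)) = fun y ↦ g.val y (Y y) (X y) :=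
  funext fun y ↦ g.symm y _ _

end Metric

section Tangent

variable {E : Type*} [NormedAddCommGroup E] [NormedSpace ℝ E]
  {H : Type*} [TopologicalSpace H] {I : ModelWithCorners ℝ E H}
  {M : Type*} [TopologicalSpace M] [ChartedSpace H M]

/-- The Levi-Civita connection of a semi-Riemannian metric on the tangent bundle. -/
abbrev nabla [IsManifold I ∞ M] (g : SemiRiemannianMetric I E (fun x : M ↦ TangentSpace I x))
    (X Y : Π x : M, TangentSpace I x) : Π x : M, TangentSpace I x :=
  (tangentAlgebroid I M).leviCivita g X Y

variable [IsManifold I ∞ M] (g : SemiRiemannianMetric I E (fun x : M ↦ TangentSpace I x))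
  {x : M} {X X' Y Y' Z : Π x : M, TangentSpace I x}

theorem tangentAlgebroid_koszul (X Y Z : Π x : M, TangentSpace I x) (x : M) :
    (tangentAlgebroid I M).koszul g X Y Z x =
      mvfderiv I (fun y ↦ g.val y (Y y) (Z y)) x (X x)
      + mvfderiv I (fun y ↦ g.val y (Z y) (X y)) x (Y x)
      - mvfderiv I (fun y ↦ g.val y (X y) (Y y)) x (Z x)
      + g.val x (VectorField.mlieBracket I X Y x) (Z x)
      - g.val x (VectorField.mlieBracket I Y Z x) (X x)
      + g.val x (VectorField.mlieBracket I Z X x) (Y x) := rfl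

theorem nabla_congr (hX : ∀ᶠ y in 𝓝 x, X y = X' y) (hY : ∀ᶠ y in 𝓝 x, Y y = Y' y) :
    nabla g X Y x = nabla g X' Y' x := by
  refine leviCivita_congr_of_koszul _ g fun Z ↦ ?_
  rw [tangentAlgebroid_koszul, tangentAlgebroid_koszul, hX.self_of_nhds, hY.self_of_nhds,
    Filter.EventuallyEq.mlieBracket_vectorField_eq hX hY,
    Filter.EventuallyEq.mlieBracket_vectorField_eq hY (.refl _ Z),
    Filter.EventuallyEq.mlieBracket_vectorField_eq (.refl _ Z) hX,
    mvfderiv_congr (f := fun y ↦ g.val y (Y y) (Z y))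
      (f' := fun y ↦ g.val y (Y' y) (Z y)),
    mvfderiv_congr (f := fun y ↦ g.val y (Z y) (X y))
      (f' := fun y ↦ g.val y (Z y) (X' y)),
    mvfderiv_congr (f := fun y ↦ g.val y (X y) (Y y))
      (f' := fun y ↦ g.val y (X' y) (Y' y))]
  · filter_upwards [hX, hY] with y h1 h2
    rw [h1, h2]
  · filter_upwards [hX] with y h1
    rw [h1]
  · filter_upwards [hY] with y h1
    rw [h1]

variable [CompleteSpace E]

/-- The right hand side of the Koszul formula depends on `Z` only through its value at the point,
which is what makes the Levi-Civita connection exist. -/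
theorem tensorialAt_koszul (hX : MDiffAt (T% X) x) (hY : MDiffAt (T% Y) x) :
    TensorialAt I E (fun Z ↦ (tangentAlgebroid I M).koszul g X Y Z x) x where
  smul {f Z} hf hZ := by
    simp only [tangentAlgebroid_koszul]
    rw [metric_symm_fun g Y, mvfderiv_metric_smul_left g hf hZ hY,
      mvfderiv_metric_smul_left g hf hZ hX, VectorField.mlieBracket_smul_right hf hZ,
      VectorField.mlieBracket_smul_left hf hZ, metric_symm_fun g Y]
    simp only [Pi.smul_apply', smul_eq_mul, add_apply, smul_apply, map_add, map_smul]
    ring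
  add {Z Z'} hZ hZ' := by
    simp only [tangentAlgebroid_koszul]
    rw [metric_symm_fun g Y, mvfderiv_metric_add_left g hZ hZ' hY,
      mvfderiv_metric_add_left g hZ hZ' hX, VectorField.mlieBracket_add_right hZ hZ',
      VectorField.mlieBracket_add_left hZ hZ', metric_symm_fun g Y, metric_symm_fun g Y]
    simp only [Pi.add_apply, add_apply, map_add]
    ring

variable [FiniteDimensional ℝ E]

/-- The Koszul formula holds for all fields differentiable at the point, although the definition
of the connection only tests against smooth ones. -/
theorem two_mul_metric_nabla (hX : MDiffAt (T% X) x) (hY : MDiffAt (T% Y) x)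
    (hZ : MDiffAt (T% Z) x) :
    2 * g.val x (nabla g X Y x) (Z x) = (tangentAlgebroid I M).koszul g X Y Z x := by
  have hT := tensorialAt_koszul g hX hY
  obtain ⟨v, hv⟩ := exists_metric_eq g x ((1 / 2 : ℝ) • (TensorialAt.mkHom _ x hT).toLinearMap)
  have hv' (Z : Π x : M, TangentSpace I x) (hZ : MDiffAt (T% Z) x) :
      2 * g.val x v (Z x) = (tangentAlgebroid I M).koszul g X Y Z x := by
    rw [hv, ← TensorialAt.mkHom_apply hT hZ]
    simp
  rw [nabla, leviCivita_eq (tangentAlgebroid I M) g fun Z hZ ↦ hv' Z (mdiffAt_section hZ),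
    hv' Z hZ]

/-- The Levi-Civita connection is metric. -/
theorem mvfderiv_metric (hX : MDiffAt (T% X) x) (hY : MDiffAt (T% Y) x) (hZ : MDiffAt (T% Z) x) :
    mvfderiv I (fun y ↦ g.val y (Y y) (Z y)) x (X x) =
      g.val x (nabla g X Y x) (Z x) + g.val x (Y x) (nabla g X Z x) := by
  have h1 := two_mul_metric_nabla g hX hY hZ
  have h2 := two_mul_metric_nabla g hX hZ hY
  rw [tangentAlgebroid_koszul] at h1 h2
  rw [metric_symm_fun g Z Y, metric_symm_fun g Y X, metric_symm_fun g X Z,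
    VectorField.mlieBracket_swap_apply (V := Z) (W := Y),
    VectorField.mlieBracket_swap_apply (V := Y) (W := X),
    VectorField.mlieBracket_swap_apply (V := X) (W := Z)] at h2
  simp only [map_neg, neg_apply] at h2
  rw [g.symm x (Y x)]
  linarith

/-- The Levi-Civita connection is torsion-free. -/
theorem nabla_sub_nabla (hX : MDiffAt (T% X) x) (hY : MDiffAt (T% Y) x) :
    nabla g X Y x - nabla g Y X x = VectorField.mlieBracket I X Y x := by
  refine eq_of_metric_eq g fun z ↦ ?_
  have hZ := FiberBundle.mdifferentiableAt_extend I E z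
  have h1 := two_mul_metric_nabla g hX hY hZ
  have h2 := two_mul_metric_nabla g hY hX hZ
  rw [tangentAlgebroid_koszul] at h1 h2
  rw [metric_symm_fun g X, metric_symm_fun g _ Y, metric_symm_fun g Y X,
    VectorField.mlieBracket_swap_apply (V := Y) (W := X),
    VectorField.mlieBracket_swap_apply (V := X) (W := FiberBundle.extend E z),
    VectorField.mlieBracket_swap_apply (V := FiberBundle.extend E z) (W := Y)] at h2
  simp only [map_neg, neg_apply, FiberBundle.extend_apply_self] at h1 h2
  rw [map_sub, sub_apply]
  linarith

/-- Additivity in the differentiated field is read off from metric compatibility; linearity in the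
direction then follows from torsion-freeness. -/
theorem nabla_add_right (hX : MDiffAt (T% X) x) (hY : MDiffAt (T% Y) x) (hY' : MDiffAt (T% Y') x) :
    nabla g X (Y + Y') x = nabla g X Y x + nabla g X Y' x := by
  refine eq_of_metric_eq g fun z ↦ ?_
  have hZ := FiberBundle.mdifferentiableAt_extend I E z
  have h := mvfderiv_metric g hX (mdifferentiableAt_add_section hY hY') hZ
  rw [mvfderiv_metric_add_left g hY hY' hZ, add_apply, mvfderiv_metric g hX hY hZ,
    mvfderiv_metric g hX hY' hZ] at h
  simp only [Pi.add_apply, map_add, add_apply, FiberBundle.extend_apply_self] at h ⊢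
  linarith

theorem nabla_smul_right {f : M → ℝ} (hf : MDiffAt f x) (hX : MDiffAt (T% X) x)
    (hY : MDiffAt (T% Y) x) :
    nabla g X (f • Y) x = mvfderiv I f x (X x) • Y x + f x • nabla g X Y x := by
  refine eq_of_metric_eq g fun z ↦ ?_
  have hZ := FiberBundle.mdifferentiableAt_extend I E z
  have h := mvfderiv_metric g hX (hf.smul_section hY) hZ
  rw [mvfderiv_metric_smul_left g hf hY hZ, add_apply, smul_apply, mvfderiv_metric g hX hY hZ] at h
  simp only [Pi.smul_apply', map_add, add_apply, map_smul, smul_apply, smul_eq_mul,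
    FiberBundle.extend_apply_self] at h ⊢
  linarith

theorem nabla_add_left (hX : MDiffAt (T% X) x) (hX' : MDiffAt (T% X') x) (hY : MDiffAt (T% Y) x) :
    nabla g (X + X') Y x = nabla g X Y x + nabla g X' Y x := by
  rw [eq_add_of_sub_eq (nabla_sub_nabla g (mdifferentiableAt_add_section hX hX') hY),
    eq_add_of_sub_eq (nabla_sub_nabla g hX hY), eq_add_of_sub_eq (nabla_sub_nabla g hX' hY),
    nabla_add_right g hY hX hX', VectorField.mlieBracket_add_left hX hX']
  abel

theorem nabla_smul_left {f : M → ℝ} (hf : MDiffAt f x) (hX : MDiffAt (T% X) x)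
    (hY : MDiffAt (T% Y) x) : nabla g (f • X) Y x = f x • nabla g X Y x := by
  rw [eq_add_of_sub_eq (nabla_sub_nabla g (hf.smul_section hX) hY),
    eq_add_of_sub_eq (nabla_sub_nabla g hX hY),
    nabla_smul_right g hf hY hX, VectorField.mlieBracket_smul_left hf hX, smul_add]
  simp only [neg_smul]
  abel

theorem contMDiffAt_nabla (hX : CMDiffAt ∞ (T% X) x) (hY : CMDiffAt ∞ (T% Y) x) :
    CMDiffAt ∞ (T% (nabla g X Y)) x := by
  refine contMDiffAt_of_metric_apply g fun Z hZ ↦ ?_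
  have hk : CMDiffAt ∞ (fun y ↦ (1 / 2 : ℝ) * (tangentAlgebroid I M).koszul g X Y Z y) x := by
    simp only [tangentAlgebroid_koszul]
    exact contMDiffAt_const.mul
      ((((((contMDiffAt_mvfderiv_apply (contMDiffAt_metric_apply g hY hZ) hX).add
        (contMDiffAt_mvfderiv_apply (contMDiffAt_metric_apply g hZ hX) hY)).sub
        (contMDiffAt_mvfderiv_apply (contMDiffAt_metric_apply g hX hY) hZ)).add
        (contMDiffAt_metric_apply g (contMDiffAt_mlieBracket hX hY) hZ)).sub
        (contMDiffAt_metric_apply g (contMDiffAt_mlieBracket hY hZ) hX)).add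
        (contMDiffAt_metric_apply g (contMDiffAt_mlieBracket hZ hX) hY))
  refine hk.congr_of_eventuallyEq ?_
  filter_upwards [eventually_mdifferentiableAt_section hX, eventually_mdifferentiableAt_section hY,
    eventually_mdifferentiableAt_section hZ] with y h1 h2 h3
  rw [← two_mul_metric_nabla g h1 h2 h3]
  ring

end Tangent

/-! ### Curvature, gradient and Hessian -/

section Tensors

variable {E : Type*} [NormedAddCommGroup E] [NormedSpace ℝ E]
  {H : Type*} [TopologicalSpace H] {I : ModelWithCorners ℝ E H}
  {M : Type*} [TopologicalSpace M] [ChartedSpace H M] [IsManifold I ∞ M]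
  (g : SemiRiemannianMetric I E (fun x : M ↦ TangentSpace I x))
  {x : M} {X X' Y Y' Z Z' : Π x : M, TangentSpace I x}

theorem eventually_nabla_congr (hX : ∀ᶠ y in 𝓝 x, X y = X' y) (hY : ∀ᶠ y in 𝓝 x, Y y = Y' y) :
    ∀ᶠ y in 𝓝 x, nabla g X Y y = nabla g X' Y' y := by
  filter_upwards [eventually_eventually_nhds.2 hX, eventually_eventually_nhds.2 hY]
    with y h1 h2 using nabla_congr g h1 h2

theorem curvature_apply (X Y Z : Π x : M, TangentSpace I x) (x : M) :
    (tangentAlgebroid I M).curvature g X Y Z x =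
      nabla g X (nabla g Y Z) x - nabla g Y (nabla g X Z) x
        - nabla g (VectorField.mlieBracket I X Y) Z x := rfl

theorem curvature_congr (hX : ∀ᶠ y in 𝓝 x, X y = X' y) (hY : ∀ᶠ y in 𝓝 x, Y y = Y' y)
    (hZ : ∀ᶠ y in 𝓝 x, Z y = Z' y) :
    (tangentAlgebroid I M).curvature g X Y Z x = (tangentAlgebroid I M).curvature g X' Y' Z' x := by
  rw [curvature_apply, curvature_apply, nabla_congr g hX (eventually_nabla_congr g hY hZ),
    nabla_congr g hY (eventually_nabla_congr g hX hZ),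
    nabla_congr g (Filter.EventuallyEq.mlieBracket_vectorField hX hY) hZ]

theorem hessian_apply (f : M → ℝ) (u v : TangentSpace I x) :
    (tangentAlgebroid I M).hessian g f x u v =
      mvfderiv I (fun y ↦ mvfderiv I f y (FiberBundle.extend E v y)) x u
      - mvfderiv I f x (nabla g (FiberBundle.extend E u) (FiberBundle.extend E v) x) := by
  change mvfderiv I (fun y ↦ mvfderiv I f y (FiberBundle.extend E v y)) x
    (FiberBundle.extend E u x) - mvfderiv I f x _ = _
  rw [FiberBundle.extend_apply_self]
  rfl

variable [FiniteDimensional ℝ E]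

theorem nabla_const_smul_right (c : ℝ) (hX : MDiffAt (T% X) x) (hY : MDiffAt (T% Y) x) :
    nabla g X (c • Y) x = c • nabla g X Y x := by
  have := nabla_smul_right g (f := fun _ ↦ c) mdifferentiableAt_const hX hY
  rw [mvfderiv_const, zero_apply, zero_smul, zero_add] at this
  exact this

theorem nabla_const_smul_left (c : ℝ) (hX : MDiffAt (T% X) x) (hY : MDiffAt (T% Y) x) :
    nabla g (c • X) Y x = c • nabla g X Y x :=
  nabla_smul_left g (f := fun _ ↦ c) mdifferentiableAt_const hX hY

theorem curvature_add_middle (hX : CMDiffAt ∞ (T% X) x) (hY : CMDiffAt ∞ (T% Y) x)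
    (hY' : CMDiffAt ∞ (T% Y') x) (hZ : CMDiffAt ∞ (T% Z) x) :
    (tangentAlgebroid I M).curvature g X (Y + Y') Z x =
      (tangentAlgebroid I M).curvature g X Y Z x + (tangentAlgebroid I M).curvature g X Y' Z x := by
  have h1 : ∀ᶠ y in 𝓝 x, nabla g (Y + Y') Z y = (nabla g Y Z + nabla g Y' Z) y := by
    filter_upwards [eventually_mdifferentiableAt_section hY,
      eventually_mdifferentiableAt_section hY', eventually_mdifferentiableAt_section hZ]
      with y h1 h2 h3 using nabla_add_left g h1 h2 h3
  have h2 : ∀ᶠ y in 𝓝 x, VectorField.mlieBracket I X (Y + Y') y =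
      (VectorField.mlieBracket I X Y + VectorField.mlieBracket I X Y') y := by
    filter_upwards [eventually_mdifferentiableAt_section hY,
      eventually_mdifferentiableAt_section hY'] with y h1 h2
      using VectorField.mlieBracket_add_right h1 h2
  simp only [curvature_apply]
  rw [nabla_congr g (.of_forall fun _ ↦ rfl) h1, nabla_congr g h2 (.of_forall fun _ ↦ rfl),
    nabla_add_right g (mdiffAt_section hX) (mdiffAt_section (contMDiffAt_nabla g hY hZ))
      (mdiffAt_section (contMDiffAt_nabla g hY' hZ)),
    nabla_add_left g (mdiffAt_section hY) (mdiffAt_section hY')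
      (mdiffAt_section (contMDiffAt_nabla g hX hZ)),
    nabla_add_left g (mdiffAt_section (contMDiffAt_mlieBracket hX hY))
      (mdiffAt_section (contMDiffAt_mlieBracket hX hY')) (mdiffAt_section hZ)]
  abel

theorem curvature_smul_middle (c : ℝ) (hX : CMDiffAt ∞ (T% X) x) (hY : CMDiffAt ∞ (T% Y) x)
    (hZ : CMDiffAt ∞ (T% Z) x) :
    (tangentAlgebroid I M).curvature g X (c • Y) Z x =
      c • (tangentAlgebroid I M).curvature g X Y Z x := by
  have h1 : ∀ᶠ y in 𝓝 x, nabla g (c • Y) Z y = (c • nabla g Y Z) y := by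
    filter_upwards [eventually_mdifferentiableAt_section hY,
      eventually_mdifferentiableAt_section hZ]
      with y h1 h3 using nabla_const_smul_left g c h1 h3
  have h2 : ∀ᶠ y in 𝓝 x, VectorField.mlieBracket I X (c • Y) y =
      (c • VectorField.mlieBracket I X Y) y := by
    filter_upwards [eventually_mdifferentiableAt_section hY] with y h1
      using VectorField.mlieBracket_const_smul_right h1
  simp only [curvature_apply]
  rw [nabla_congr g (.of_forall fun _ ↦ rfl) h1, nabla_congr g h2 (.of_forall fun _ ↦ rfl),
    nabla_const_smul_right g c (mdiffAt_section hX) (mdiffAt_section (contMDiffAt_nabla g hY hZ)),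
    nabla_const_smul_left g c (mdiffAt_section hY) (mdiffAt_section (contMDiffAt_nabla g hX hZ)),
    nabla_const_smul_left g c (mdiffAt_section (contMDiffAt_mlieBracket hX hY))
      (mdiffAt_section hZ)]
  simp only [smul_sub]

theorem curvature_add_right (hX : CMDiffAt ∞ (T% X) x) (hY : CMDiffAt ∞ (T% Y) x)
    (hZ : CMDiffAt ∞ (T% Z) x) (hZ' : CMDiffAt ∞ (T% Z') x) :
    (tangentAlgebroid I M).curvature g X Y (Z + Z') x =
      (tangentAlgebroid I M).curvature g X Y Z x + (tangentAlgebroid I M).curvature g X Y Z' x := by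
  have h1 {X : Π x : M, TangentSpace I x} (hX : CMDiffAt ∞ (T% X) x) :
      ∀ᶠ y in 𝓝 x, nabla g X (Z + Z') y = (nabla g X Z + nabla g X Z') y := by
    filter_upwards [eventually_mdifferentiableAt_section hX,
      eventually_mdifferentiableAt_section hZ, eventually_mdifferentiableAt_section hZ']
      with y h1 h2 h3 using nabla_add_right g h1 h2 h3
  simp only [curvature_apply]
  rw [nabla_congr g (.of_forall fun _ ↦ rfl) (h1 hY),
    nabla_congr g (.of_forall fun _ ↦ rfl) (h1 hX),
    nabla_add_right g (mdiffAt_section hX) (mdiffAt_section (contMDiffAt_nabla g hY hZ))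
      (mdiffAt_section (contMDiffAt_nabla g hY hZ')),
    nabla_add_right g (mdiffAt_section hY) (mdiffAt_section (contMDiffAt_nabla g hX hZ))
      (mdiffAt_section (contMDiffAt_nabla g hX hZ')),
    nabla_add_right g (mdiffAt_section (contMDiffAt_mlieBracket hX hY))
      (mdiffAt_section hZ) (mdiffAt_section hZ')]
  abel

theorem curvature_smul_right (c : ℝ) (hX : CMDiffAt ∞ (T% X) x) (hY : CMDiffAt ∞ (T% Y) x)
    (hZ : CMDiffAt ∞ (T% Z) x) :
    (tangentAlgebroid I M).curvature g X Y (c • Z) x =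
      c • (tangentAlgebroid I M).curvature g X Y Z x := by
  have h1 {X : Π x : M, TangentSpace I x} (hX : CMDiffAt ∞ (T% X) x) :
      ∀ᶠ y in 𝓝 x, nabla g X (c • Z) y = (c • nabla g X Z) y := by
    filter_upwards [eventually_mdifferentiableAt_section hX,
      eventually_mdifferentiableAt_section hZ]
      with y h1 h2 using nabla_const_smul_right g c h1 h2
  simp only [curvature_apply]
  rw [nabla_congr g (.of_forall fun _ ↦ rfl) (h1 hY),
    nabla_congr g (.of_forall fun _ ↦ rfl) (h1 hX),
    nabla_const_smul_right g c (mdiffAt_section hX) (mdiffAt_section (contMDiffAt_nabla g hY hZ)),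
    nabla_const_smul_right g c (mdiffAt_section hY) (mdiffAt_section (contMDiffAt_nabla g hX hZ)),
    nabla_const_smul_right g c (mdiffAt_section (contMDiffAt_mlieBracket hX hY))
      (mdiffAt_section hZ)]
  simp only [smul_sub]

/-- The bilinear map `(w, z) ↦ R(u,w)z` on the tangent space at `x`. Linearity of the curvature over
the constants is enough here, since `FiberBundle.extend` is linear near `x`. -/
def curvatureBilin (x : M) (u : TangentSpace I x) :
    TangentSpace I x →ₗ[ℝ] TangentSpace I x →ₗ[ℝ] TangentSpace I x :=
  LinearMap.mk₂ ℝ (fun w z ↦ (tangentAlgebroid I M).curvatureTensor g x u w z)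
    (fun w w' _ ↦ (curvature_congr g (.of_forall fun _ ↦ rfl) (eventually_extend_add (F := E) w w')
      (.of_forall fun _ ↦ rfl)).trans (curvature_add_middle g (contMDiffAt_extend_tangent _)
        (contMDiffAt_extend_tangent _) (contMDiffAt_extend_tangent _)
        (contMDiffAt_extend_tangent _)))
    (fun c w _ ↦ (curvature_congr g (.of_forall fun _ ↦ rfl) (eventually_extend_smul (F := E) c w)
      (.of_forall fun _ ↦ rfl)).trans (curvature_smul_middle g c (contMDiffAt_extend_tangent _)
        (contMDiffAt_extend_tangent _) (contMDiffAt_extend_tangent _)))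
    (fun _ z z' ↦ (curvature_congr g (.of_forall fun _ ↦ rfl) (.of_forall fun _ ↦ rfl)
      (eventually_extend_add (F := E) z z')).trans (curvature_add_right g
        (contMDiffAt_extend_tangent _) (contMDiffAt_extend_tangent _)
        (contMDiffAt_extend_tangent _) (contMDiffAt_extend_tangent _)))
    (fun c _ z ↦ (curvature_congr g (.of_forall fun _ ↦ rfl) (.of_forall fun _ ↦ rfl)
      (eventually_extend_smul (F := E) c z)).trans (curvature_smul_right g c
        (contMDiffAt_extend_tangent _) (contMDiffAt_extend_tangent _)
        (contMDiffAt_extend_tangent _)))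

/-- The linear map `u ↦ ∇_u X` on the tangent space at `x`, for `X` smooth at `x`. -/
def nablaLinear (hX : CMDiffAt ∞ (T% X) x) : TangentSpace I x →ₗ[ℝ] TangentSpace I x where
  toFun u := nabla g (FiberBundle.extend E u) X x
  map_add' u v := (nabla_congr g (eventually_extend_add (F := E) u v)
    (.of_forall fun _ ↦ rfl)).trans (nabla_add_left g
      (mdiffAt_section (contMDiffAt_extend_tangent _))
      (mdiffAt_section (contMDiffAt_extend_tangent _)) (mdiffAt_section hX))
  map_smul' c v := (nabla_congr g (eventually_extend_smul (F := E) c v)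
    (.of_forall fun _ ↦ rfl)).trans (nabla_const_smul_left g c
      (mdiffAt_section (contMDiffAt_extend_tangent _)) (mdiffAt_section hX))

/-- `∇_X G` at a point depends on `X` only through its value there. -/
theorem nablaLinear_apply {G : Π x : M, TangentSpace I x} (hG : CMDiffAt ∞ (T% G) x)
    (hX : CMDiffAt ∞ (T% X) x) : nablaLinear g hG (X x) = nabla g X G x := by
  have h := (TensorialAt.mk (I := I) (F := E) (Φ := fun X ↦ nabla g X G x) (x := x)
    (fun hf hσ ↦ nabla_smul_left g hf hσ (mdiffAt_section hG))
    (fun hσ hσ' ↦ nabla_add_left g hσ hσ' (mdiffAt_section hG)))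
  exact h.pointwise (mdiffAt_section (contMDiffAt_extend_tangent _)) (mdiffAt_section hX)
    (FiberBundle.extend_apply_self ..)

/-- The gradient of a function with respect to a semi-Riemannian metric: the vector representing
its differential. -/
def gradient (f : M → ℝ) (x : M) : TangentSpace I x :=
  (exists_metric_eq g x (mvfderiv I f x).toLinearMap).choose

theorem metric_gradient (f : M → ℝ) (x : M) (v : TangentSpace I x) :
    g.val x (gradient g f x) v = mvfderiv I f x v :=
  (exists_metric_eq g x (mvfderiv I f x).toLinearMap).choose_spec v

theorem contMDiffAt_gradient {f : M → ℝ} (hf : CMDiffAt ∞ f x) :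
    CMDiffAt ∞ (T% (gradient g f)) x :=
  contMDiffAt_of_metric_apply g fun Y hY ↦ by
    simpa only [metric_gradient] using contMDiffAt_mvfderiv_apply hf hY

theorem hessian_eq_metric {f : M → ℝ} (hf : CMDiffAt ∞ f x) (u v : TangentSpace I x) :
    (tangentAlgebroid I M).hessian g f x u v =
      g.val x (nabla g (FiberBundle.extend E u) (gradient g f) x) v := by
  have h := mvfderiv_metric g (mdiffAt_section (contMDiffAt_extend_tangent u))
    (mdiffAt_section (contMDiffAt_gradient g hf)) (mdiffAt_section (contMDiffAt_extend_tangent v))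
  simp only [metric_gradient, FiberBundle.extend_apply_self] at h
  rw [hessian_apply, h]
  ring

end Tensors

/-! ### The connection of the graded metric -/

section Graded

variable {E : Type*} [NormedAddCommGroup E] [NormedSpace ℝ E]
  {H : Type*} [TopologicalSpace H] {I : ModelWithCorners ℝ E H}
  {M : Type*} [TopologicalSpace M] [ChartedSpace H M]

theorem mvfderiv_exp_two_mul {x : M} {θ : M → ℝ} (hθ : MDiffAt θ x) :
    mvfderiv I (fun y ↦ Real.exp (2 * θ y)) x = (2 * Real.exp (2 * θ x)) • mvfderiv I θ x := by
  have h1 : HasFDerivAt (fun t : ℝ ↦ Real.exp (2 * t))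
      (ContinuousLinearMap.toSpanSingleton ℝ (2 * Real.exp (2 * θ x))) (θ x) := by
    have := ((hasDerivAt_id (θ x)).const_mul 2).exp
    simp only [id, mul_one] at this
    rw [mul_comm]
    exact this.hasFDerivAt
  have h2 := (h1.hasMFDerivAt.comp x hθ.hasMFDerivAt).mfderiv
  refine ContinuousLinearMap.ext fun v ↦ ?_
  have h3 := congrArg (fun L ↦ L v) h2
  refine Eq.trans h3 ?_
  exact mul_comm (mvfderiv I θ x v) (2 * Real.exp (2 * θ x))

theorem mdifferentiableAt_exp_two_mul {x : M} {θ : M → ℝ} (hθ : MDiffAt θ x) :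
    MDiffAt (fun y ↦ Real.exp (2 * θ y)) x := by
  have h1 : DifferentiableAt ℝ (fun t : ℝ ↦ Real.exp (2 * t)) (θ x) := by fun_prop
  exact h1.mdifferentiableAt.comp x hθ

variable [IsManifold I ∞ M]

theorem contMDiffAt_graded_fst {n : ℕ∞ω} {Z : Π x, GradedTangentSpace I M x} {x : M}
    (hZ : ContMDiffAt I (I.prod 𝓘(ℝ, E × ℝ)) n (fun y ↦ TotalSpace.mk' (E × ℝ) y (Z y)) x) :
    ContMDiffAt I (I.prod 𝓘(ℝ, E)) n
      (fun y ↦ (TotalSpace.mk' E y (Z y).1 : TotalSpace E (fun x : M ↦ TangentSpace I x))) x := by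
  rw [contMDiffAt_section] at hZ ⊢
  exact (ContinuousLinearMap.fst ℝ E ℝ).contMDiff.contMDiffAt.comp x hZ

theorem contMDiffAt_graded_snd {n : ℕ∞ω} {Z : Π x, GradedTangentSpace I M x} {x : M}
    (hZ : ContMDiffAt I (I.prod 𝓘(ℝ, E × ℝ)) n (fun y ↦ TotalSpace.mk' (E × ℝ) y (Z y)) x) :
    ContMDiffAt I 𝓘(ℝ) n (fun y ↦ ((Z y).2 : ℝ)) x := by
  rw [contMDiffAt_section] at hZ
  have h := ContMDiffAt.comp x (ContinuousLinearMap.snd ℝ E ℝ).contMDiff.contMDiffAt hZ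
  exact h

/-- Near `x`, the standard extension of a vector `(v, a)` of the graded tangent bundle has constant
second component. -/
theorem eventually_extend_graded (u : GradedTangentSpace I M x) :
    ∀ᶠ y in 𝓝 x, FiberBundle.extend (E × ℝ) u y = (FiberBundle.extend E u.1 y, u.2) := by
  have hx := FiberBundle.mem_baseSet_trivializationAt E (fun x : M ↦ TangentSpace I x) x
  filter_upwards [(trivializationAt E (fun x : M ↦ TangentSpace I x) x).open_baseSet.mem_nhds hx]
    with y hy
  have hy' : y ∈ (trivializationAt (E × ℝ) (GradedTangentSpace I M) x).baseSet :=
    ⟨hy, Set.mem_univ _⟩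
  -- The trivialization of the direct sum acts on the two components separately.
  have h₁ : (trivializationAt E (fun x : M ↦ TangentSpace I x) x ⟨x, u.1⟩).2 =
      (trivializationAt E (fun x : M ↦ TangentSpace I x) x ⟨y, FiberBundle.extend E u.1 y⟩).2 :=
    have h₀ := congrArg Prod.snd
      ((trivializationAt E (fun x : M ↦ TangentSpace I x) x).apply_mk_symm hy
        (trivializationAt E (fun x : M ↦ TangentSpace I x) x ⟨x, u.1⟩).2)
    h₀.symm
  have h : (trivializationAt (E × ℝ) (GradedTangentSpace I M) x ⟨x, u⟩).2 =
      (trivializationAt (E × ℝ) (GradedTangentSpace I M) x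
        ⟨y, (FiberBundle.extend E u.1 y, u.2)⟩).2 :=
    Prod.ext h₁ rfl
  exact (congrArg ((trivializationAt (E × ℝ) (GradedTangentSpace I M) x).symm y) h).trans
    ((trivializationAt (E × ℝ) (GradedTangentSpace I M) x).symm_apply_apply_mk hy' _)

variable (g : SemiRiemannianMetric I E (fun x : M ↦ TangentSpace I x)) (θ : M → ℝ)
  (hθ : ContMDiff I 𝓘(ℝ) ∞ θ)

theorem gradedMetric_apply (x : M) (u v : GradedTangentSpace I M x) :
    (gradedMetric g θ hθ).val x u v =
      g.val x u.1 v.1 + Real.exp (2 * θ x) * ((u.2 : ℝ) * (v.2 : ℝ)) := rfl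

variable {θ} {x : M} {X Y Z : Π x : M, TangentSpace I x} {h k l : M → ℝ}

theorem mvfderiv_graded_metric (hθ : MDiffAt θ x) (hX : MDiffAt (T% X) x)
    (hY : MDiffAt (T% Y) x) (hh : MDiffAt h x) (hk : MDiffAt k x) (v : TangentSpace I x) :
    mvfderiv I (fun y ↦ g.val y (X y) (Y y) + Real.exp (2 * θ y) * (h y * k y)) x v =
      mvfderiv I (fun y ↦ g.val y (X y) (Y y)) x v +
      Real.exp (2 * θ x) * (h x * mvfderiv I k x v + k x * mvfderiv I h x v
        + 2 * (h x * k x) * mvfderiv I θ x v) := by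
  have he := mdifferentiableAt_exp_two_mul hθ
  have hhk : MDiffAt (fun y ↦ h y * k y) x := hh.mul hk
  have hehk : MDiffAt (fun y ↦ Real.exp (2 * θ y) * (h y * k y)) x := he.mul hhk
  rw [mvfderiv_fun_add (mdifferentiableAt_metric_apply g hX hY) hehk,
    mvfderiv_fun_mul he hhk, mvfderiv_fun_mul hh hk, mvfderiv_exp_two_mul hθ]
  simp only [add_apply, smul_apply, smul_eq_mul]
  ring

/-- The Koszul expressions of `ĝ` and `g` differ only by terms in `dθ` and `X(k)`: the other
derivatives of `h`, `k` and `l` cancel against the odd parts of the brackets. -/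
theorem graded_koszul (hX : MDiffAt (T% X) x) (hY : MDiffAt (T% Y) x) (hZ : MDiffAt (T% Z) x)
    (hh : MDiffAt h x) (hk : MDiffAt k x) (hl : MDiffAt l x) :
    (gradedAlgebroid I M).koszul (gradedMetric g θ hθ) (fun y ↦ (X y, h y)) (fun y ↦ (Y y, k y))
        (fun y ↦ (Z y, l y)) x =
      (tangentAlgebroid I M).koszul g X Y Z x +
        2 * Real.exp (2 * θ x) * (l x * mvfderiv I k x (X x) + k x * l x * mvfderiv I θ x (X x)
          + h x * l x * mvfderiv I θ x (Y x) - h x * k x * mvfderiv I θ x (Z x)) := by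
  have hθ' : MDiffAt θ x := (hθ x).mdifferentiableAt (by simp)
  have e1 := mvfderiv_graded_metric g hθ' hY hZ hk hl (X x)
  have e2 := mvfderiv_graded_metric g hθ' hZ hX hl hh (Y x)
  have e3 := mvfderiv_graded_metric g hθ' hX hY hh hk (Z x)
  change mvfderiv I (fun y ↦ g.val y (Y y) (Z y) + Real.exp (2 * θ y) * (k y * l y)) x (X x)
    + mvfderiv I (fun y ↦ g.val y (Z y) (X y) + Real.exp (2 * θ y) * (l y * h y)) x (Y x)
    - mvfderiv I (fun y ↦ g.val y (X y) (Y y) + Real.exp (2 * θ y) * (h y * k y)) x (Z x)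
    + (g.val x (VectorField.mlieBracket I X Y x) (Z x) + Real.exp (2 * θ x) *
      ((mvfderiv I k x (X x) - mvfderiv I h x (Y x)) * l x))
    - (g.val x (VectorField.mlieBracket I Y Z x) (X x) + Real.exp (2 * θ x) *
      ((mvfderiv I l x (Y x) - mvfderiv I k x (Z x)) * h x))
    + (g.val x (VectorField.mlieBracket I Z X x) (Y x) + Real.exp (2 * θ x) *
      ((mvfderiv I h x (Z x) - mvfderiv I l x (X x)) * k x)) = _
  rw [e1, e2, e3, tangentAlgebroid_koszul]
  ring

/-- The vector field `e^{2θ} grad θ`, which is `-∇̂_ξ ξ`. -/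
def warpField [FiniteDimensional ℝ E]
    (g : SemiRiemannianMetric I E (fun x : M ↦ TangentSpace I x)) (θ : M → ℝ) :
    Π x : M, TangentSpace I x :=
  (fun x ↦ Real.exp (2 * θ x)) • gradient g θ

variable [FiniteDimensional ℝ E]

theorem metric_warpField (x : M) (v : TangentSpace I x) :
    g.val x (warpField g θ x) v = Real.exp (2 * θ x) * mvfderiv I θ x v := by
  rw [warpField, Pi.smul_apply', map_smul, smul_apply, metric_gradient, smul_eq_mul]

theorem leviCivita_graded_pair (hX : MDiffAt (T% X) x) (hY : MDiffAt (T% Y) x)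
    (hh : MDiffAt h x) (hk : MDiffAt k x) :
    (gradedAlgebroid I M).leviCivita (gradedMetric g θ hθ) (fun y ↦ (X y, h y))
        (fun y ↦ (Y y, k y)) x =
      (nabla g X Y x - (h x * k x) • warpField g θ x,
        mvfderiv I k x (X x) + k x * mvfderiv I θ x (X x) + h x * mvfderiv I θ x (Y x)) := by
  refine leviCivita_eq _ _ fun Z hZ ↦ ?_
  have hZ1 := (contMDiffAt_graded_fst hZ).mdifferentiableAt (by simp)
  have hZ2 := (contMDiffAt_graded_snd hZ).mdifferentiableAt (by simp)
  refine Eq.trans ?_ (graded_koszul g hθ hX hY hZ1 hh hk hZ2).symm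
  have : CompleteSpace E := FiniteDimensional.complete ℝ E
  rw [gradedMetric_apply, ← two_mul_metric_nabla g hX hY hZ1]
  simp only [map_sub, sub_apply, map_smul, smul_apply, smul_eq_mul, metric_warpField]
  ring

/-- The Levi-Civita connection of the graded metric,
`∇̂_{X + hξ} (Y + kξ) = ∇_X Y - h k e^{2θ} grad θ + (X(k) + k X(θ) + h Y(θ)) ξ`.
It is stated for sections that are only near `x` of the given form, so that it applies to iterated
covariant derivatives. -/
theorem leviCivita_graded {S T : Π x, GradedTangentSpace I M x}
    (hS : ∀ᶠ y in 𝓝 x, S y = (X y, h y)) (hT : ∀ᶠ y in 𝓝 x, T y = (Y y, k y))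
    (hX : MDiffAt (T% X) x) (hY : MDiffAt (T% Y) x)
    (hh : MDiffAt h x) (hk : MDiffAt k x) :
    (gradedAlgebroid I M).leviCivita (gradedMetric g θ hθ) S T x =
      (nabla g X Y x - (h x * k x) • warpField g θ x,
        mvfderiv I k x (X x) + k x * mvfderiv I θ x (X x) + h x * mvfderiv I θ x (Y x)) := by
  have hS1 : ∀ᶠ y in 𝓝 x, (S y).1 = X y := hS.mono fun y hy ↦ congrArg Prod.fst hy
  have hS2 : ∀ᶠ y in 𝓝 x, (S y).2 = h y := hS.mono fun y hy ↦ congrArg Prod.snd hy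
  have hT1 : ∀ᶠ y in 𝓝 x, (T y).1 = Y y := hT.mono fun y hy ↦ congrArg Prod.fst hy
  have hT2 : ∀ᶠ y in 𝓝 x, (T y).2 = k y := hT.mono fun y hy ↦ congrArg Prod.snd hy
  have key := leviCivita_graded_pair g hθ (X := fun y ↦ (S y).1) (Y := fun y ↦ (T y).1)
    (h := fun y ↦ (S y).2) (k := fun y ↦ (T y).2)
    (hX.congr_of_eventuallyEq (hS1.mono fun y hy ↦ congrArg (TotalSpace.mk y) hy))
    (hY.congr_of_eventuallyEq (hT1.mono fun y hy ↦ congrArg (TotalSpace.mk y) hy))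
    (hh.congr_of_eventuallyEq hS2) (hk.congr_of_eventuallyEq hT2)
  have : CompleteSpace E := FiniteDimensional.complete ℝ E
  rw [nabla_congr g hS1 hT1, mvfderiv_congr hT2, hS1.self_of_nhds, hT1.self_of_nhds,
    hS2.self_of_nhds, hT2.self_of_nhds] at key
  exact key

end Graded

/-! ### The curvature and the Hessian of the graded metric -/

section GradedCurvature

variable {E : Type*} [NormedAddCommGroup E] [NormedSpace ℝ E] [FiniteDimensional ℝ E]
  {H : Type*} [TopologicalSpace H] {I : ModelWithCorners ℝ E H}
  {M : Type*} [TopologicalSpace M] [ChartedSpace H M] [IsManifold I ∞ M]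
  (g : SemiRiemannianMetric I E (fun x : M ↦ TangentSpace I x)) {θ : M → ℝ}
  (hθ : ContMDiff I 𝓘(ℝ) ∞ θ)
  {x : M} {X Y Z : Π x : M, TangentSpace I x} {a b c : ℝ}
  {S T U : Π x, GradedTangentSpace I M x}

/-- The endomorphism `v ↦ ∇_v grad θ + dθ(v) grad θ` of the tangent space at `x`. It is metrically
equivalent to `Hes(θ) + dθ ⊗ dθ = e^{-θ} Hes(e^θ)`. -/
def warpEndo (x : M) : TangentSpace I x →ₗ[ℝ] TangentSpace I x :=
  nablaLinear g (contMDiffAt_gradient g (hθ x)) +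
    (mvfderiv I θ x).toLinearMap.smulRight (gradient g θ x)

theorem contMDiffAt_warpField (hθ : ContMDiff I 𝓘(ℝ) ∞ θ) (x : M) :
    CMDiffAt ∞ (T% (warpField g θ)) x :=
  have he : CMDiffAt ∞ (fun x ↦ Real.exp (2 * θ x)) x :=
    (Real.contDiff_exp.contMDiff.comp (contMDiff_const.mul hθ)) x
  he.smul_section (contMDiffAt_gradient g (hθ x))

theorem nabla_warpField (hX : CMDiffAt ∞ (T% X) x) :
    nabla g X (warpField g θ) x =
      Real.exp (2 * θ x) • (warpEndo g hθ x (X x) + mvfderiv I θ x (X x) • gradient g θ x) := by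
  have : CompleteSpace E := FiniteDimensional.complete ℝ E
  have hθ' : MDiffAt θ x := (hθ x).mdifferentiableAt (by simp)
  have hG := contMDiffAt_gradient g (hθ x)
  have h1 := nablaLinear_apply g hG hX
  rw [warpField, nabla_smul_right g (mdifferentiableAt_exp_two_mul hθ') (mdiffAt_section hX)
    (mdiffAt_section hG), mvfderiv_exp_two_mul hθ', ← h1, warpEndo]
  simp only [smul_apply, smul_eq_mul, LinearMap.add_apply, LinearMap.smulRight_apply,
    ContinuousLinearMap.coe_coe]
  module

theorem metric_warpEndo (hX : CMDiffAt ∞ (T% X) x) (hZ : CMDiffAt ∞ (T% Z) x) :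
    g.val x (warpEndo g hθ x (X x)) (Z x) =
      mvfderiv I (fun y ↦ mvfderiv I θ y (Z y)) x (X x) - mvfderiv I θ x (nabla g X Z x)
        + mvfderiv I θ x (X x) * mvfderiv I θ x (Z x) := by
  have : CompleteSpace E := FiniteDimensional.complete ℝ E
  have hG := contMDiffAt_gradient g (hθ x)
  have h := mvfderiv_metric g (mdiffAt_section hX) (mdiffAt_section hG) (mdiffAt_section hZ)
  simp only [metric_gradient] at h
  rw [h, warpEndo, LinearMap.add_apply, nablaLinear_apply g hG hX, LinearMap.smulRight_apply,
    map_add, add_apply, map_smul, smul_apply, metric_gradient]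
  simp

/-- The curvature of the graded metric on fields with constant odd components. With
`K = warpEndo g hθ x`, the terms beyond `R(X,Y)Z` are
`e^{2θ} c (a K Y - b K X) + (b g(K X, Z) - a g(K Y, Z)) ξ`. -/
theorem curvature_graded (hS : ∀ᶠ y in 𝓝 x, S y = (X y, a)) (hT : ∀ᶠ y in 𝓝 x, T y = (Y y, b))
    (hU : ∀ᶠ y in 𝓝 x, U y = (Z y, c)) (hX : CMDiffAt ∞ (T% X) x) (hY : CMDiffAt ∞ (T% Y) x)
    (hZ : CMDiffAt ∞ (T% Z) x) :
    (gradedAlgebroid I M).curvature (gradedMetric g θ hθ) S T U x =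
      ((tangentAlgebroid I M).curvature g X Y Z x + (Real.exp (2 * θ x) * c) •
          (a • warpEndo g hθ x (Y x) - b • warpEndo g hθ x (X x)),
        b * g.val x (warpEndo g hθ x (X x)) (Z x) - a * g.val x (warpEndo g hθ x (Y x)) (Z x)) := by
  have : CompleteSpace E := FiniteDimensional.complete ℝ E
  -- The iterated covariant derivative, in the form needed for both orders of `S` and `T`.
  have second {S T : Π x, GradedTangentSpace I M x} {X Y : Π x : M, TangentSpace I x} {a b c : ℝ}
      (hS : ∀ᶠ y in 𝓝 x, S y = (X y, a)) (hT : ∀ᶠ y in 𝓝 x, T y = (Y y, b))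
      (hU : ∀ᶠ y in 𝓝 x, U y = (Z y, c)) (hX : CMDiffAt ∞ (T% X) x) (hY : CMDiffAt ∞ (T% Y) x) :
      (gradedAlgebroid I M).leviCivita (gradedMetric g θ hθ) S
        ((gradedAlgebroid I M).leviCivita (gradedMetric g θ hθ) T U) x =
      (nabla g X (nabla g Y Z) x - (b * c) • nabla g X (warpField g θ) x
          - (a * (c * mvfderiv I θ x (Y x) + b * mvfderiv I θ x (Z x))) • warpField g θ x,
        c * mvfderiv I (fun y ↦ mvfderiv I θ y (Y y)) x (X x)
          + b * mvfderiv I (fun y ↦ mvfderiv I θ y (Z y)) x (X x)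
          + (c * mvfderiv I θ x (Y x) + b * mvfderiv I θ x (Z x)) * mvfderiv I θ x (X x)
          + a * (mvfderiv I θ x (nabla g Y Z x)
            - b * c * mvfderiv I θ x (warpField g θ x))) := by
    have h1 : ∀ᶠ y in 𝓝 x, (gradedAlgebroid I M).leviCivita (gradedMetric g θ hθ) T U y =
        ((nabla g Y Z + (-(b * c)) • warpField g θ) y,
          c * mvfderiv I θ y (Y y) + b * mvfderiv I θ y (Z y)) := by
      filter_upwards [eventually_eventually_nhds.2 hT, eventually_eventually_nhds.2 hU,
        eventually_mdifferentiableAt_section hY, eventually_mdifferentiableAt_section hZ]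
        with y h1 h2 h3 h4
      rw [leviCivita_graded g hθ (h := fun _ ↦ b) (k := fun _ ↦ c) h1 h2 h3 h4
        mdifferentiableAt_const mdifferentiableAt_const, mvfderiv_const]
      simp only [zero_apply, zero_add, Pi.add_apply, Pi.smul_apply, Pi.neg_apply, neg_smul,
        sub_eq_add_neg]
    have hYZ := contMDiffAt_nabla g hY hZ
    have hG := contMDiffAt_warpField g hθ x
    have dY : MDiffAt (fun y ↦ mvfderiv I θ y (Y y)) x :=
      (contMDiffAt_mvfderiv_apply (hθ x) hY).mdifferentiableAt (by simp)
    have dZ : MDiffAt (fun y ↦ mvfderiv I θ y (Z y)) x :=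
      (contMDiffAt_mvfderiv_apply (hθ x) hZ).mdifferentiableAt (by simp)
    have dcY : MDiffAt (fun y ↦ c * mvfderiv I θ y (Y y)) x := mdifferentiableAt_const.mul dY
    have dbZ : MDiffAt (fun y ↦ b * mvfderiv I θ y (Z y)) x := mdifferentiableAt_const.mul dZ
    have hcG : MDiffAt (T% ((-(b * c)) • warpField g θ)) x :=
      (mdifferentiableAt_const (c := -(b * c))).smul_section (mdiffAt_section hG)
    rw [leviCivita_graded g hθ (h := fun _ ↦ a) hS h1 (mdiffAt_section hX)
      (mdifferentiableAt_add_section (mdiffAt_section hYZ) hcG) mdifferentiableAt_const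
      (dcY.add dbZ), nabla_add_right g (mdiffAt_section hX) (mdiffAt_section hYZ) hcG,
      nabla_const_smul_right g _ (mdiffAt_section hX) (mdiffAt_section hG),
      mvfderiv_fun_add dcY dbZ, mvfderiv_fun_mul mdifferentiableAt_const dY,
      mvfderiv_fun_mul mdifferentiableAt_const dZ, mvfderiv_const, mvfderiv_const]
    simp only [Pi.add_apply, Pi.smul_apply, Pi.neg_apply, neg_smul, map_add, map_neg, map_smul,
      add_apply, smul_apply, smul_eq_mul, zero_apply, mul_zero, add_zero]
    refine Prod.ext ?_ ?_
    · simp only [sub_eq_add_neg]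
    · simp only []
      ring
  -- The bracket has no odd component since the odd components of `S` and `T` are constant.
  have hb : ∀ᶠ y in 𝓝 x, (gradedAlgebroid I M).bracket S T y =
      (VectorField.mlieBracket I X Y y, (0 : ℝ)) := by
    filter_upwards [eventually_eventually_nhds.2 hS, eventually_eventually_nhds.2 hT] with y h1 h2
    refine Prod.ext (Filter.EventuallyEq.mlieBracket_vectorField_eq
      (h1.mono fun y hy ↦ congrArg Prod.fst hy) (h2.mono fun y hy ↦ congrArg Prod.fst hy)) ?_
    have e1 : mvfderiv I (fun y ↦ ((S y).2 : ℝ)) y = 0 :=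
      (mvfderiv_congr (h1.mono fun y hy ↦ congrArg Prod.snd hy)).trans (mvfderiv_const a)
    have e2 : mvfderiv I (fun y ↦ ((T y).2 : ℝ)) y = 0 :=
      (mvfderiv_congr (h2.mono fun y hy ↦ congrArg Prod.snd hy)).trans (mvfderiv_const b)
    simp only [gradedAlgebroid, e1, e2]
    simp
  have hlie := mvfderiv_mlieBracket (hθ x) hX hY
  have hXY := contMDiffAt_mlieBracket hX hY
  rw [AlgebroidOps.curvature, second hS hT hU hX hY, second hT hS hU hY hX,
    leviCivita_graded g hθ (h := fun _ ↦ 0) (k := fun _ ↦ c) hb hU (mdiffAt_section hXY)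
      (mdiffAt_section hZ) mdifferentiableAt_const mdifferentiableAt_const, mvfderiv_const,
    nabla_warpField g hθ hX, nabla_warpField g hθ hY, curvature_apply, metric_warpEndo g hθ hX hZ,
    metric_warpEndo g hθ hY hZ, warpField]
  refine Prod.ext ?_ ?_
  · simp only [Prod.fst_sub, Pi.smul_apply']
    module
  · simp only [Prod.snd_sub, zero_apply]
    -- Second derivatives of `θ` enter through `[X, Y](θ) = X(Y(θ)) - Y(X(θ))`.
    rw [hlie]
    ring

theorem curvatureTensor_graded (u w z : GradedTangentSpace I M x) :
    (gradedAlgebroid I M).curvatureTensor (gradedMetric g θ hθ) x u w z =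
      ((tangentAlgebroid I M).curvatureTensor g x u.1 w.1 z.1 + (Real.exp (2 * θ x) * z.2) •
          ((u.2 : ℝ) • warpEndo g hθ x w.1 - (w.2 : ℝ) • warpEndo g hθ x u.1),
        (w.2 : ℝ) * g.val x (warpEndo g hθ x u.1) z.1
          - (u.2 : ℝ) * g.val x (warpEndo g hθ x w.1) z.1) := by
  have h := curvature_graded g hθ (eventually_extend_graded u) (eventually_extend_graded w)
    (eventually_extend_graded z) (contMDiffAt_extend_tangent _) (contMDiffAt_extend_tangent _)
    (contMDiffAt_extend_tangent _)
  simp only [FiberBundle.extend_apply_self] at h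
  exact h

theorem hessian_graded (u v : GradedTangentSpace I M x) :
    (gradedAlgebroid I M).hessian (gradedMetric g θ hθ) θ x u v =
      (tangentAlgebroid I M).hessian g θ x u.1 v.1
        + u.2 * v.2 * (Real.exp (2 * θ x) * mvfderiv I θ x (gradient g θ x)) := by
  have hu := mdiffAt_section (contMDiffAt_extend_tangent u.1)
  have hv := mdiffAt_section (contMDiffAt_extend_tangent v.1)
  have h1 := leviCivita_graded g hθ (h := fun _ ↦ (u.2 : ℝ)) (k := fun _ ↦ (v.2 : ℝ))
    (eventually_extend_graded u) (eventually_extend_graded v) hu hv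
    mdifferentiableAt_const mdifferentiableAt_const
  have h2 : mvfderiv I (fun y ↦ mvfderiv I θ y (FiberBundle.extend (E × ℝ) v y).1) x =
      mvfderiv I (fun y ↦ mvfderiv I θ y (FiberBundle.extend E v.1 y)) x :=
    mvfderiv_congr ((eventually_extend_graded v).mono fun y hy ↦ by rw [hy])
  change mvfderiv I (fun y ↦ mvfderiv I θ y (FiberBundle.extend (E × ℝ) v y).1) x
    (FiberBundle.extend (E × ℝ) u x).1 - mvfderiv I θ x ((gradedAlgebroid I M).leviCivita _ _ _ x).1
    = _
  rw [h1, h2, hessian_apply, FiberBundle.extend_apply_self, warpField]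
  simp only [map_sub, map_smul, Pi.smul_apply', smul_eq_mul]
  ring

end GradedCurvature

/-! ### Metric traces -/

/-- If `T(w, z) = B(z, A w)`, the metric trace of `T` is the trace of the endomorphism `A`. -/
theorem metricTrace_eq_trace {W : Type*} [AddCommGroup W] [Module ℝ W] [FiniteDimensional ℝ W]
    {B : LinearMap.BilinForm ℝ W} (hB : B.Nondegenerate) {T : W → W → ℝ} (A : W →ₗ[ℝ] W)
    (hT : ∀ w z, T w z = B z (A w)) : metricTrace B hB T = LinearMap.trace ℝ W A := by
  classical
  rw [LinearMap.trace_eq_matrix_trace ℝ (Module.finBasis ℝ W), Matrix.trace, metricTrace]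
  refine Finset.sum_congr rfl fun i _ ↦ ?_
  rw [hT, Matrix.diag_apply, LinearMap.toMatrix_apply]
  conv_lhs => rw [← (Module.finBasis ℝ W).sum_repr (A (Module.finBasis ℝ W i))]
  simp only [map_sum, map_smul, LinearMap.BilinForm.apply_dualBasis_left hB]
  simp

/-- The trace of an endomorphism of `W × ℝ` is the sum of the traces of its diagonal blocks. -/
theorem trace_prod {W : Type*} [AddCommGroup W] [Module ℝ W] [FiniteDimensional ℝ W]
    (A : W × ℝ →ₗ[ℝ] W × ℝ) : LinearMap.trace ℝ (W × ℝ) A =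
      LinearMap.trace ℝ W (LinearMap.fst ℝ W ℝ ∘ₗ A ∘ₗ LinearMap.inl ℝ W ℝ) + (A (0, 1)).2 := by
  have h1 : A = (LinearMap.inl ℝ W ℝ ∘ₗ (LinearMap.fst ℝ W ℝ ∘ₗ A) +
      LinearMap.inr ℝ W ℝ ∘ₗ (LinearMap.snd ℝ W ℝ ∘ₗ A)) := by
    ext <;> simp
  conv_lhs => rw [h1]
  rw [map_add, LinearMap.trace_comp_comm', LinearMap.trace_comp_comm' _ (LinearMap.inr ℝ W ℝ)]
  congr 1
  rw [LinearMap.trace_eq_matrix_trace ℝ (Module.Basis.singleton Unit ℝ)]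
  simp [Matrix.trace, LinearMap.toMatrix_apply]

/-! ### The Ricci tensor of the graded metric -/

section Ricci

variable {E : Type*} [NormedAddCommGroup E] [NormedSpace ℝ E] [FiniteDimensional ℝ E]
  {H : Type*} [TopologicalSpace H] {I : ModelWithCorners ℝ E H}
  {M : Type*} [TopologicalSpace M] [ChartedSpace H M] [IsManifold I ∞ M]
  (g : SemiRiemannianMetric I E (fun x : M ↦ TangentSpace I x)) {θ : M → ℝ}
  (hθ : ContMDiff I 𝓘(ℝ) ∞ θ) {x : M}

theorem tangent_trace_eq_trace {T : TangentSpace I x → TangentSpace I x → ℝ}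
    (A : TangentSpace I x →ₗ[ℝ] TangentSpace I x) (hT : ∀ w z, T w z = g.val x z (A w)) :
    g.trace x T = LinearMap.trace ℝ (TangentSpace I x) A :=
  haveI : FiniteDimensional ℝ (TangentSpace I x) := inferInstanceAs (FiniteDimensional ℝ E)
  metricTrace_eq_trace (g.form_nondegenerate x) A hT

/-- The Ricci curvature `Ric(u, v)` is the trace of the endomorphism `A` that is metrically
equivalent to `(w, z) ↦ g(R(u,w)z, v)`. -/
theorem exists_ricciEndo (u v : TangentSpace I x) :
    ∃ A : TangentSpace I x →ₗ[ℝ] TangentSpace I x,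
      (∀ w z, g.val x ((tangentAlgebroid I M).curvatureTensor g x u w z) v = g.val x z (A w)) ∧
      LinearMap.trace ℝ (TangentSpace I x) A = (tangentAlgebroid I M).ricci g x u v := by
  have : FiniteDimensional ℝ (TangentSpace I x) := inferInstanceAs (FiniteDimensional ℝ E)
  let A : TangentSpace I x →ₗ[ℝ] TangentSpace I x :=
    ((g.form x).toDual (g.form_nondegenerate x)).symm.toLinearMap ∘ₗ
      (curvatureBilin g x u).compr₂ ((g.form x).flip v)
  have hA (w z : TangentSpace I x) :
      g.val x ((tangentAlgebroid I M).curvatureTensor g x u w z) v = g.val x z (A w) := by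
    rw [g.symm x z]
    exact (LinearMap.BilinForm.apply_toDual_symm_apply (hB := g.form_nondegenerate x)
      (((curvatureBilin g x u).compr₂ ((g.form x).flip v)) w) z).symm
  exact ⟨A, hA, (tangent_trace_eq_trace g A hA).symm⟩

theorem trace_warpEndo :
    LinearMap.trace ℝ (TangentSpace I x) (warpEndo g hθ x) =
      (tangentAlgebroid I M).laplacian g θ x + mvfderiv I θ x (gradient g θ x) := by
  have : FiniteDimensional ℝ (TangentSpace I x) := inferInstanceAs (FiniteDimensional ℝ E)
  rw [warpEndo, map_add, LinearMap.trace_smulRight, AlgebroidOps.laplacian,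
    tangent_trace_eq_trace g (nablaLinear g (contMDiffAt_gradient g (hθ x)))
      fun w z ↦ (hessian_eq_metric g (hθ x) w z).trans (g.symm x _ _)]
  rfl

theorem metric_warpEndo_eq_hessian (u v : TangentSpace I x) :
    g.val x (warpEndo g hθ x u) v =
      (tangentAlgebroid I M).hessian g θ x u v + mvfderiv I θ x u * mvfderiv I θ x v := by
  have h := metric_warpEndo g hθ (contMDiffAt_extend_tangent u) (contMDiffAt_extend_tangent v)
  simp only [FiberBundle.extend_apply_self] at h
  rw [h, hessian_apply]

/-- The Ricci tensor of the graded metric. With `û = (u, a)`, `v̂ = (v, s)` and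
`K = warpEndo g hθ x`, the form `(ŵ, ẑ) ↦ ⟨R̂(û,ŵ)ẑ, v̂⟩` is metrically equivalent to an
endomorphism of `T_xM × ℝ` whose diagonal blocks are `A - e^{2θ} a s K`, with `A` as in
`exists_ricciEndo`, and `-g(K u, v)`. -/
theorem ricci_graded (u v : GradedTangentSpace I M x) :
    (gradedAlgebroid I M).ricci (gradedMetric g θ hθ) x u v =
      (tangentAlgebroid I M).ricci g x u.1 v.1 - (tangentAlgebroid I M).hessian g θ x u.1 v.1
        - mvfderiv I θ x u.1 * mvfderiv I θ x v.1
        - u.2 * v.2 * (Real.exp (2 * θ x) * ((tangentAlgebroid I M).laplacian g θ x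
          + mvfderiv I θ x (gradient g θ x))) := by
  have : FiniteDimensional ℝ (TangentSpace I x) := inferInstanceAs (FiniteDimensional ℝ E)
  obtain ⟨A, hA, hAtr⟩ := exists_ricciEndo g u.1 v.1
  let K := warpEndo g hθ x
  let Ku : TangentSpace I x := K u.1
  let φ : TangentSpace I x →ₗ[ℝ] ℝ := (g.form x).flip v.1 ∘ₗ K
  -- The endomorphism metrically equivalent to `(w, z) ↦ ⟨R(u,w)z, v⟩`, in block form.
  let B : TangentSpace I x × ℝ →ₗ[ℝ] TangentSpace I x × ℝ :=
    LinearMap.prod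
      (LinearMap.coprod (A - (Real.exp (2 * θ x) * (v.2 * u.2)) • K)
        (LinearMap.toSpanSingleton ℝ _ ((Real.exp (2 * θ x) * v.2) • Ku)))
      (LinearMap.coprod ((u.2 : ℝ) • φ) (LinearMap.toSpanSingleton ℝ ℝ (-(g.val x Ku v.1))))
  have hB (w z : GradedTangentSpace I M x) :
      gradedForm g θ x ((gradedAlgebroid I M).curvatureTensor (gradedMetric g θ hθ) x u w z) v =
        gradedForm g θ x z (B w) := by
    rw [curvatureTensor_graded, gradedForm_apply, gradedForm_apply]
    change g.val x (_ + (Real.exp (2 * θ x) * z.2) • ((u.2 : ℝ) • K w.1 - (w.2 : ℝ) • Ku)) v.1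
        + Real.exp (2 * θ x)
          * (((w.2 : ℝ) * g.val x Ku z.1 - (u.2 : ℝ) * g.val x (K w.1) z.1) * v.2)
      = g.val x z.1 ((A w.1 - (Real.exp (2 * θ x) * (v.2 * u.2)) • K w.1)
          + (w.2 : ℝ) • (Real.exp (2 * θ x) * v.2) • Ku)
        + Real.exp (2 * θ x) * (z.2 * ((u.2 : ℝ) * g.val x (K w.1) v.1
          + (w.2 : ℝ) * (-(g.val x Ku v.1))))
    simp only [map_add, map_sub, map_smul, add_apply, sub_apply, smul_apply, smul_eq_mul, hA]
    rw [g.symm x Ku z.1, g.symm x (K w.1) z.1]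
    ring
  have htr : (gradedAlgebroid I M).ricci (gradedMetric g θ hθ) x u v =
      LinearMap.trace ℝ (TangentSpace I x × ℝ) B :=
    metricTrace_eq_trace (W := TangentSpace I x × ℝ)
      ((gradedMetric g θ hθ).form_nondegenerate x) B hB
  have h1 : LinearMap.fst ℝ (TangentSpace I x) ℝ ∘ₗ B ∘ₗ LinearMap.inl ℝ (TangentSpace I x) ℝ =
      A - (Real.exp (2 * θ x) * (v.2 * u.2)) • K := by
    ext w
    simp [B]
  have h2 : (B (0, 1)).2 = -(g.val x Ku v.1) := by simp [B]
  rw [htr, trace_prod, h1, h2, map_sub, map_smul, hAtr, trace_warpEndo, metric_warpEndo_eq_hessian,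
    smul_eq_mul]
  ring

end Ricci

end GradedTangent

end

theorem mainTheorem2
    {E : Type*} [NormedAddCommGroup E] [NormedSpace ℝ E] [FiniteDimensional ℝ E]
    {H : Type*} [TopologicalSpace H] (I : ModelWithCorners ℝ E H) [I.Boundaryless]
    {M : Type*} [TopologicalSpace M] [ChartedSpace H M] [IsManifold I ∞ M]
    (g : GradedTangent.SemiRiemannianMetric I E (fun x : M ↦ TangentSpace I x))
    (θ : M → ℝ) (hθ : ContMDiff I 𝓘(ℝ) ∞ θ) :
    ((∀ (x : M) (u v : TangentSpace I x),
        (GradedTangent.tangentAlgebroid I M).ricci g x u v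
          = 2 * (mvfderiv I θ x u * mvfderiv I θ x v))
      ∧ ∀ x : M, (GradedTangent.tangentAlgebroid I M).laplacian g θ x = 0)
    ↔ ∀ (x : M) (u v : GradedTangent.GradedTangentSpace I M x),
        (GradedTangent.gradedAlgebroid I M).ricci (GradedTangent.gradedMetric g θ hθ) x u v
          = (GradedTangent.gradedAlgebroid I M).d θ x u * (GradedTangent.gradedAlgebroid I M).d θ x v
            - (GradedTangent.gradedAlgebroid I M).hessian
                (GradedTangent.gradedMetric g θ hθ) θ x u v := by
  have hd (x : M) (u : GradedTangent.GradedTangentSpace I M x) :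
      (GradedTangent.gradedAlgebroid I M).d θ x u = mvfderiv I θ x u.1 := rfl
  simp only [GradedTangent.ricci_graded, GradedTangent.hessian_graded, hd]
  constructor
  · rintro ⟨hR, hL⟩ x u v
    rw [hR, hL]
    ring
  · refine fun h ↦ ⟨fun x u v ↦ ?_, fun x ↦ ?_⟩
    · have := h x (u, (0 : ℝ)) (v, (0 : ℝ))
      simp only at this
      linarith
    · have h0 := h x ((0 : TangentSpace I x), (0 : ℝ)) ((0 : TangentSpace I x), (0 : ℝ))
      have h1 := h x ((0 : TangentSpace I x), (1 : ℝ)) ((0 : TangentSpace I x), (1 : ℝ))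
      simp only at h0 h1
      refine (mul_eq_zero.1 (?_ : Real.exp (2 * θ x) * _ = 0)).resolve_left (Real.exp_ne_zero _)
      linarith
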